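/- Let $n\ge 2$, let $\mu_1,\dots,\mu_n>0$, let $\mathcal{C}\ell_n$ be the real Clifford algebra generated by $e_1,\dots,e_n$ with $e_ie_j+e_je_i=-2\delta_{ij}$, and let $V$ be a representation space of $\mathcal{C}\ell_n$. On $V$-valued polynomials in $x_1,\dots,x_n$ let $r_i$ be the reflection $x_i\mapsto -x_i$, $T_i=\partial_{x_i}+\frac{\mu_i}{x_i}(1-r_i)$ the Dunkl operators, and $$\underline D_{[\ell]}=\sum_{i=1}^{\ell}e_iT_i,\qquad \underline x_{[\ell]}=\sum_{i=1}^{\ell}e_ix_i,\qquad \|x_{[\ell]}\|^2=\sum_{i=1}^{\ell}x_i^2,\qquad \gamma_{[\ell]}=\frac{\ell}{2}+\sum_{i=1}^{\ell}\mu_i .$$ For $2\le \ell\le n$ let $\mathbf{CK}_{x_\ell}^{\mu_\ell}$ be the Cauchy–Kovalevskaia extension operator $$\mathbf{CK}_{x_\ell}^{\mu_\ell}=\Gamma(\mu_\ell+\tfrac12)\Big[\widetilde I_{\mu_\ell-1/2}(x_\ell\underline D_{[\ell-1]})+\tfrac12\,e_\ell x_\ell\underline D_{[\ell-1]}\,\widetilde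 I_{\mu_\ell+1/2}(x_\ell\underline D_{[\ell-1]})\Big],$$ where $\widetilde I_\alpha(z)=(2/z)^\alpha I_\alpha(z)=\sum_{r\ge0}\frac{(z/2)^{2r}}{r!\,\Gamma(r+\alpha+1)}$ and $I_\alpha$ is the modified Bessel function (the sum is finite on each polynomial in $x_1,\dots,x_{\ell-1}$). For non-negative integers $\mathbf j=(j_1,\dots,j_{n-1})$ and $v_s\in V$ (for instance a member of a fixed basis of $V$) put $$\Psi_{\mathbf j}^s(x_1,\dots,x_n)=\mathbf{CK}_{x_n}^{\mu_n}\Big[\underline x_{[n-1]}^{\,j_{n-1}}\mathbf{CK}_{x_{n-1}}^{\mu_{n-1}}\Big[\underline x_{[n-2]}^{\,j_{n-2}}\cdots\mathbf{CK}_{x_3}^{\mu_3}\big[\underline x_{[2]}^{\,j_2}\mathbf{CK}_{x_2}^{\mu_2}[x_1^{j_1}]\big]\cdots\Big]\Big]v_s .$$ Write $|\mathbf j_\ell|=j_1+\dots+j_\ell$, let $P_k^{(a,b)}$ be the Jacobi polynomials with $P_{-1}^{(a,b)}=0$, let $(a)_k=\Gamma(a+k)/\Gamma(a)$, and for $3\le\ell\le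 n$ put $$t_\ell=\frac{x_\ell^2-\|x_{[\ell-1]}\|^2}{\|x_{[\ell]}\|^2},\qquad t_2=\frac{x_2^2-x_1^2}{x_1^2+x_2^2},\qquad a_\ell=|\mathbf j_{\ell-2}|+\gamma_{[\ell-1]} .$$ Then $$\Psi_{\mathbf j}^s(x_1,\dots,x_n)=Q_{j_{n-1}}(x_n,\underline x_{[n-1]})\,Q_{j_{n-2}}(x_{n-1},\underline x_{[n-2]})\cdots Q_{j_2}(x_3,\underline x_{[2]})\;m_{j_1}(x_2,x_1)\,v_s ,$$ where $Q_{j_{\ell-1}}(x_\ell,\underline x_{[\ell-1]})$ is $$\frac{\beta!\,\|x_{[\ell]}\|^{2\beta}}{(\mu_\ell+1/2)_\beta}\Big[P_\beta^{(a_\ell-1,\,\mu_\ell-1/2)}(t_\ell)-\frac{e_\ell x_\ell\,\underline x_{[\ell-1]}}{\|x_{[\ell]}\|^2}P_{\beta-1}^{(a_\ell,\,\mu_\ell+1/2)}(t_\ell)\Big]\quad\text{if } j_{\ell-1}=2\beta,$$ $$\frac{\beta!\,\|x_{[\ell]}\|^{2\beta}}{(\mu_\ell+1/2)_\beta}\Big[\underline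 x_{[\ell-1]}P_\beta^{(a_\ell,\,\mu_\ell-1/2)}(t_\ell)-e_\ell x_\ell\,\frac{\beta+a_\ell}{\beta+\mu_\ell+1/2}\,P_\beta^{(a_\ell-1,\,\mu_\ell+1/2)}(t_\ell)\Big]\quad\text{if } j_{\ell-1}=2\beta+1,$$ and $m_{j_1}(x_2,x_1)$ is $$\frac{(-1)^\beta\beta!\,(x_1^2+x_2^2)^\beta}{(\mu_2+1/2)_\beta}\Big[P_\beta^{(\mu_1-1/2,\,\mu_2-1/2)}(t_2)-\frac{e_2e_1x_2x_1}{x_1^2+x_2^2}P_{\beta-1}^{(\mu_1+1/2,\,\mu_2+1/2)}(t_2)\Big]\quad\text{if } j_1=2\beta,$$ $$\frac{(-1)^\beta\beta!\,(x_1^2+x_2^2)^\beta}{(\mu_2+1/2)_\beta}\Big[x_1P_\beta^{(\mu_1+1/2,\,\mu_2-1/2)}(t_2)+\frac{\beta+\mu_1+1/2}{\beta+\mu_2+1/2}\,e_2e_1x_2\,P_\beta^{(\mu_1-1/2,\,\mu_2+1/2)}(t_2)\Big]\quad\text{if } j_1=2\beta+1.$$ The identity holds at every point of $\mathbb R^n$;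 where $\|x_{[\ell]}\|^2=0$ for some $\ell\ge2$, the factors are read with the conventions $0^0=1$ and $a/0=0$, which give the values of their polynomial continuations. -/

import Mathlib

open scoped TensorProduct Nat

namespace DiracDunkl

noncomputable section

/-! Variables, Clifford generators and parameters are indexed by `Fin n`, starting from `0`:
the variable `x_ℓ` of the text is `x i` with `(i : ℕ) = ℓ - 1`. -/

/-- The indices of the first `l` variables. -/
def seg (n l : ℕ) : Finset (Fin n) := Finset.univ.filter fun i => (i : ℕ) < l

/-! ### The Clifford algebra of negative signature -/

/-- The quadratic form `v ↦ -(v_1² + ⋯ + v_n²)` on `ℝⁿ`. -/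
def negForm (n : ℕ) : QuadraticForm ℝ (Fin n → ℝ) :=
  QuadraticMap.weightedSumSquares ℝ (fun _ : Fin n => (-1 : ℝ))

/-- The real Clifford algebra generated by `e_1, …, e_n` with `e_i e_j + e_j e_i = -2 δ_ij`. -/
abbrev Cl (n : ℕ) : Type := CliffordAlgebra (negForm n)

/-- The Clifford generator `e_i`. -/
def e {n : ℕ} (i : Fin n) : Cl n := CliffordAlgebra.ι (negForm n) (Pi.single i 1)

theorem e_mul_self {n : ℕ} (i : Fin n) : e i * e i = -1 := by
  have h : negForm n (Pi.single i 1) = -1 := by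
    simp [negForm, QuadraticMap.weightedSumSquares_apply, Pi.single_apply]
  rw [e, CliffordAlgebra.ι_sq_scalar, h]
  simp

theorem e_anticomm {n : ℕ} {i j : Fin n} (hij : i ≠ j) : e i * e j + e j * e i = 0 := by
  have h : QuadraticMap.polar (negForm n) (Pi.single i 1) (Pi.single j 1) = 0 := by
    have h1 : ∀ k : Fin n, (Pi.single i 1 : Fin n → ℝ) k * (Pi.single j 1 : Fin n → ℝ) k = 0 := by
      intro k
      by_cases hk : k = i
      · subst hk
        simp [hij]
      · simp [hk]
    simp only [QuadraticMap.polar, negForm, QuadraticMap.weightedSumSquares_apply, Pi.add_apply]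
    rw [← Finset.sum_sub_distrib, ← Finset.sum_sub_distrib]
    refine Finset.sum_eq_zero fun k _ => ?_
    simp only [smul_eq_mul]
    linear_combination -2 * h1 k
  rw [e, e, CliffordAlgebra.ι_mul_ι_add_swap, h, map_zero]

/-! ### Dunkl operators on real polynomials -/

/-- The reflection `r_i`, replacing `x_i` by `-x_i`. -/
def refl {n : ℕ} (i : Fin n) : MvPolynomial (Fin n) ℝ →ₐ[ℝ] MvPolynomial (Fin n) ℝ :=
  MvPolynomial.aeval fun k => if k = i then -MvPolynomial.X k else MvPolynomial.X k

/-- Division by `x_i`, discarding the monomials that do not contain `x_i`. -/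
def divX {n : ℕ} (i : Fin n) : MvPolynomial (Fin n) ℝ →ₗ[ℝ] MvPolynomial (Fin n) ℝ where
  toFun p := p.divMonomial (Finsupp.single i 1)
  map_add' p q := MvPolynomial.add_divMonomial p q _
  map_smul' c p := by
    ext s
    simp [MvPolynomial.coeff_divMonomial]

/-- The Dunkl operator `T_i = ∂_i + (μ_i / x_i) (1 - r_i)`. -/
def dunkl {n : ℕ} (μ : Fin n → ℝ) (i : Fin n) :
    MvPolynomial (Fin n) ℝ →ₗ[ℝ] MvPolynomial (Fin n) ℝ :=
  (MvPolynomial.pderiv i).toLinearMap +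
    μ i • (divX i ∘ₗ (LinearMap.id - (refl i).toLinearMap))

/-- The division in the definition of `dunkl` is exact. -/
theorem X_mul_divX_sub_refl {n : ℕ} (i : Fin n) (p : MvPolynomial (Fin n) ℝ) :
    MvPolynomial.X i * divX i (p - refl i p) = p - refl i p := by
  have hdvd : (MvPolynomial.X i : MvPolynomial (Fin n) ℝ) ∣ p - refl i p := by
    induction p using MvPolynomial.induction_on with
    | C a => simp [refl]
    | add p q hp hq =>
      rw [map_add, add_sub_add_comm]
      exact dvd_add hp hq
    | mul_X p k hp =>
      by_cases hk : k = i
      · subst hk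
        rw [map_mul]
        refine dvd_sub (dvd_mul_left _ _) (Dvd.dvd.mul_left ?_ _)
        simp [refl]
      · have h2 : refl i (MvPolynomial.X k) = MvPolynomial.X k := by simp [refl, hk]
        rw [map_mul, h2, ← sub_mul]
        exact Dvd.dvd.mul_right hp _
  obtain ⟨q, hq⟩ := hdvd
  rw [hq]
  simp [divX]

/-! ### Operators on `V`-valued polynomials `ℝ[x_1, …, x_n] ⊗ V` -/

section Operators

variable {n : ℕ} (V : Type*) [AddCommGroup V] [Module ℝ V] [Module (Cl n) V]
  [IsScalarTower ℝ (Cl n) V]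

/-- Action of the generator `e_i` on `V`-valued polynomials. -/
def genOp (i : Fin n) : Module.End ℝ (MvPolynomial (Fin n) ℝ ⊗[ℝ] V) :=
  LinearMap.lTensor (MvPolynomial (Fin n) ℝ) (DistribSMul.toLinearMap ℝ V (e i))

/-- Multiplication of `V`-valued polynomials by `x_i`. -/
def mulOp (i : Fin n) : Module.End ℝ (MvPolynomial (Fin n) ℝ ⊗[ℝ] V) :=
  LinearMap.rTensor V (LinearMap.mulLeft ℝ (MvPolynomial.X i))

/-- The Dunkl operator `T_i` on `V`-valued polynomials. -/
def dunklOp (μ : Fin n → ℝ) (i : Fin n) : Module.End ℝ (MvPolynomial (Fin n) ℝ ⊗[ℝ] V) :=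
  LinearMap.rTensor V (dunkl μ i)

/-- The position operator `x_[ℓ] = e_1 x_1 + ⋯ + e_ℓ x_ℓ`. -/
def posOp (l : ℕ) : Module.End ℝ (MvPolynomial (Fin n) ℝ ⊗[ℝ] V) :=
  ∑ i ∈ seg n l, genOp V i * mulOp V i

/-- The Dirac-Dunkl operator `D_[ℓ] = e_1 T_1 + ⋯ + e_ℓ T_ℓ`. -/
def diracOp (μ : Fin n → ℝ) (l : ℕ) : Module.End ℝ (MvPolynomial (Fin n) ℝ ⊗[ℝ] V) :=
  ∑ i ∈ seg n l, genOp V i * dunklOp V μ i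

end Operators

/-- `Ĩ_α(A) f` for an operator `A` some power of which annihilates `f`, where
`Ĩ_α(z) = (2/z)^α I_α(z) = ∑_l (z/2)^(2l) / (l! Γ(l + α + 1))` and `I_α` is the modified Bessel
function. Only finitely many terms of the sum are nonzero. -/
def besselOp {W : Type*} [AddCommGroup W] [Module ℝ W] (α : ℝ) (A : Module.End ℝ W) (f : W) : W :=
  ∑ᶠ l : ℕ, (1 / (2 ^ (2 * l) * (l ! : ℝ) * Real.Gamma (l + α + 1))) • (A ^ (2 * l)) f

section Basis

variable {n : ℕ} {V : Type*} [AddCommGroup V] [Module ℝ V] [Module (Cl n) V]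
  [IsScalarTower ℝ (Cl n) V]

/-- The Cauchy-Kovalevskaia extension in the variable `x_i`,
`Γ(μ_i + 1/2) [Ĩ_{μ_i - 1/2}(x_i D) + (1/2) e_i x_i D Ĩ_{μ_i + 1/2}(x_i D)]`, where `D` is the
Dirac-Dunkl operator in the variables preceding `x_i`. -/
def CK (μ : Fin n → ℝ) (i : Fin n) (f : MvPolynomial (Fin n) ℝ ⊗[ℝ] V) :
    MvPolynomial (Fin n) ℝ ⊗[ℝ] V :=
  Real.Gamma (μ i + 1 / 2) •
    (besselOp (μ i - 1 / 2) (mulOp V i * diracOp V μ i) f +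
      (1 / 2 : ℝ) • (genOp V i * mulOp V i * diracOp V μ i)
        (besselOp (μ i + 1 / 2) (mulOp V i * diracOp V μ i) f))

/-- The value at the point `x` of a `V`-valued polynomial. -/
def evalAt (x : Fin n → ℝ) (f : MvPolynomial (Fin n) ℝ ⊗[ℝ] V) : V :=
  TensorProduct.lid ℝ V (LinearMap.rTensor V (MvPolynomial.aeval x).toLinearMap f)

end Basis

section Tower

variable {m : ℕ} {V : Type*} [AddCommGroup V] [Module ℝ V] [Module (Cl (m + 2)) V]
  [IsScalarTower ℝ (Cl (m + 2)) V]

/-- The first `l + 1` stages of the tower of extensions,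
`CK_{x_{l+2}}[x_[l+1]^{j_{l+1}} CK_{x_{l+1}}[⋯ x_[2]^{j_2} CK_{x_2}[x_1^{j_1}]]] v`. The number of
variables is `n = m + 2` and the multi-index is `(j_1, …, j_{n-1}) = (j 0, …, j m)`. -/
def tower (μ : Fin (m + 2) → ℝ) (j : Fin (m + 1) → ℕ) (v : V) :
    (l : ℕ) → l ≤ m → MvPolynomial (Fin (m + 2)) ℝ ⊗[ℝ] V
  | 0, _ => CK μ 1 ((MvPolynomial.X 0 ^ j 0) ⊗ₜ[ℝ] v)
  | l + 1, h =>
      CK μ (⟨l, h⟩ : Fin m).succ.succ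
        ((posOp V (l + 2) ^ j (⟨l, h⟩ : Fin m).succ) (tower μ j v l (Nat.le_of_succ_le h)))

/-- The function `Ψ_j`, a `V`-valued polynomial in `n = m + 2` variables, built from `v ∈ V`. -/
def Psi (μ : Fin (m + 2) → ℝ) (j : Fin (m + 1) → ℕ) (v : V) :
    MvPolynomial (Fin (m + 2)) ℝ ⊗[ℝ] V :=
  tower μ j v m le_rfl

end Tower

/-! ### The explicit expressions -/

/-- The Jacobi polynomial
`P_k^{(a,b)}(t) = ∑_s C(k+a, k-s) C(k+b, s) ((t-1)/2)^s ((t+1)/2)^(k-s)` for `k ≥ 0`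
(generalized binomial coefficients), and `P_k^{(a,b)} = 0` for `k < 0`. -/
def jacobi : ℤ → ℝ → ℝ → ℝ → ℝ
  | Int.ofNat k, a, b, t =>
      ∑ s ∈ Finset.range (k + 1), Ring.choose ((k : ℝ) + a) (k - s) * Ring.choose ((k : ℝ) + b) s *
        ((t - 1) / 2) ^ s * ((t + 1) / 2) ^ (k - s)
  | Int.negSucc _, _, _, _ => 0

/-- The Pochhammer symbol `(a)_k`. -/
def poch (a : ℝ) (k : ℕ) : ℝ := (ascPochhammer ℝ k).eval a

section Explicit

variable {n : ℕ}

/-- `γ_[ℓ] = ℓ/2 + μ_1 + ⋯ + μ_ℓ` (for `ℓ ≤ n`). -/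
def gam (μ : Fin n → ℝ) (l : ℕ) : ℝ := (l : ℝ) / 2 + ∑ i ∈ seg n l, μ i

/-- `‖x_[ℓ]‖² = x_1² + ⋯ + x_ℓ²`. -/
def normSq (x : Fin n → ℝ) (l : ℕ) : ℝ := ∑ i ∈ seg n l, x i ^ 2

/-- The Clifford element `x_[ℓ] = e_1 x_1 + ⋯ + e_ℓ x_ℓ` at the point `x`. -/
def vec (x : Fin n → ℝ) (l : ℕ) : Cl n := ∑ i ∈ seg n l, x i • e i

/-- `|j_ℓ| = j_1 + ⋯ + j_ℓ`. -/
def partialSum {k : ℕ} (j : Fin k → ℕ) (l : ℕ) : ℕ := ∑ i ∈ seg k l, j i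

/-- The argument `(x_ℓ² - ‖x_[ℓ-1]‖²) / ‖x_[ℓ]‖²` of the Jacobi polynomials, where `x i = x_ℓ`. -/
def jacobiArg (x : Fin n → ℝ) (i : Fin n) : ℝ := (x i ^ 2 - normSq x i) / normSq x (i + 1)

/-- The factor `Q_k(x_ℓ, x_[ℓ-1])`, where `x i = x_ℓ`, `β = ⌊k/2⌋` and `d = |j_{ℓ-2}|`. -/
def Q (μ x : Fin n → ℝ) (d k : ℕ) (i : Fin n) : Cl n :=
  (((k / 2) ! : ℝ) * normSq x (i + 1) ^ (k / 2) / poch (μ i + 1 / 2) (k / 2)) •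
    if Even k then
      algebraMap ℝ (Cl n)
          (jacobi ((k / 2 : ℕ) : ℤ) (d + gam μ i - 1) (μ i - 1 / 2) (jacobiArg x i)) -
        (jacobi (((k / 2 : ℕ) : ℤ) - 1) (d + gam μ i) (μ i + 1 / 2) (jacobiArg x i) *
          (x i / normSq x (i + 1))) • (e i * vec x i)
    else
      jacobi ((k / 2 : ℕ) : ℤ) (d + gam μ i) (μ i - 1 / 2) (jacobiArg x i) • vec x i -
        ((((k / 2 : ℕ) : ℝ) + d + gam μ i) / (((k / 2 : ℕ) : ℝ) + μ i + 1 / 2) * x i *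
          jacobi ((k / 2 : ℕ) : ℤ) (d + gam μ i - 1) (μ i + 1 / 2) (jacobiArg x i)) • e i

end Explicit

section Product

variable {m : ℕ}

/-- The factor `m_k(x_2, x_1)`, with `β = ⌊k/2⌋`; here `x_1 = x 0` and `x_2 = x 1`. -/
def mFactor (μ x : Fin (m + 2) → ℝ) (k : ℕ) : Cl (m + 2) :=
  ((-1) ^ (k / 2) * ((k / 2) ! : ℝ) * (x 0 ^ 2 + x 1 ^ 2) ^ (k / 2) /
      poch (μ 1 + 1 / 2) (k / 2)) •
    if Even k then
      algebraMap ℝ (Cl (m + 2))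
          (jacobi ((k / 2 : ℕ) : ℤ) (μ 0 - 1 / 2) (μ 1 - 1 / 2)
            ((x 1 ^ 2 - x 0 ^ 2) / (x 0 ^ 2 + x 1 ^ 2))) -
        (x 1 * x 0 / (x 0 ^ 2 + x 1 ^ 2) *
          jacobi (((k / 2 : ℕ) : ℤ) - 1) (μ 0 + 1 / 2) (μ 1 + 1 / 2)
            ((x 1 ^ 2 - x 0 ^ 2) / (x 0 ^ 2 + x 1 ^ 2))) • (e 1 * e 0)
    else
      algebraMap ℝ (Cl (m + 2))
          (x 0 * jacobi ((k / 2 : ℕ) : ℤ) (μ 0 + 1 / 2) (μ 1 - 1 / 2)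
            ((x 1 ^ 2 - x 0 ^ 2) / (x 0 ^ 2 + x 1 ^ 2))) +
        ((((k / 2 : ℕ) : ℝ) + μ 0 + 1 / 2) / (((k / 2 : ℕ) : ℝ) + μ 1 + 1 / 2) * x 1 *
          jacobi ((k / 2 : ℕ) : ℤ) (μ 0 - 1 / 2) (μ 1 + 1 / 2)
            ((x 1 ^ 2 - x 0 ^ 2) / (x 0 ^ 2 + x 1 ^ 2))) • (e 1 * e 0)

/-- The ordered product `Q_{j_{n-1}}(x_n, x_[n-1]) ⋯ Q_{j_2}(x_3, x_[2])`, the factor with the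
largest index on the left; `n = m + 2`, the index `i` stands for `ℓ = i + 3`, and `d = |j_{ℓ-2}|`. -/
def QProd (μ x : Fin (m + 2) → ℝ) (j : Fin (m + 1) → ℕ) : Cl (m + 2) :=
  (List.ofFn fun i : Fin m =>
    Q μ x (partialSum j (i + 1)) (j i.succ) i.succ.succ).reverse.prod

end Product

end

end DiracDunkl

namespace DiracDunkl

/-! ### Generalized binomial coefficients, Pochhammer symbols and Jacobi polynomials -/

/-! The proof rests on the `osp(1|2)` relation `posOp_mul_diracOp_add`: position and Dirac-Dunkl
operators anticommute to `-2(E + γ)`. If `F` is homogeneous in the first `l` variables and `D F = 0`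
(`IsMonogenic`), this relation makes `D` send `x^p F` to a scalar multiple of `x^(p-1) F`, with
explicit scalars. Hence every term of the Cauchy-Kovalevskaia series of `x^p F` is explicit.

Two facts follow. The extension is again monogenic, with one more variable
(`IsMonogenic.CK_posOp_pow`), because `D` of the series telescopes. Its value at a point is `Q`
times the value of `F` (`IsMonogenic.evalHom_CK_posOp_pow`): there `x²` becomes the scalar `-‖x‖²`,
so each Bessel series becomes a finite scalar sum, which is a Jacobi polynomial
(`bessel_sum_eq_jacobi`). Induction along the tower multiplies the factors.

The tower starts from constants, which are monogenic in one variable. Since `x_[1] = e_1 x_1`, the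
monomial `x_1^k v` is `x_[1]^k` applied to the constant `(-e_1)^k v`, so the innermost factor is `Q
(-e_1)^k`, which is `mFactor`. -/

theorem factorial_mul_choose_eq_prod (z : ℝ) (s : ℕ) :
    (s ! : ℝ) * Ring.choose z s = ∏ i ∈ Finset.range s, (z - i) := by
  have h := Ring.descPochhammer_eq_factorial_smul_choose z s
  rw [nsmul_eq_mul] at h
  rw [← h, Polynomial.descPochhammer_smeval_eq_ascPochhammer,
    Polynomial.ascPochhammer_smeval_eq_eval, ← descPochhammer_eval_eq_ascPochhammer]
  clear h
  induction s with
  | zero => simp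
  | succ s ih => rw [descPochhammer_succ_eval, Finset.prod_range_succ, ih]

theorem poch_succ (a : ℝ) (k : ℕ) : poch a (k + 1) = poch a k * (a + k) :=
  ascPochhammer_succ_eval k a

theorem poch_zero (a : ℝ) : poch a 0 = 1 := by simp [poch]

theorem poch_pos {a : ℝ} (ha : 0 < a) (k : ℕ) : 0 < poch a k := ascPochhammer_pos k a ha

theorem poch_succ_left (a : ℝ) (k : ℕ) : poch a (k + 1) = a * poch (a + 1) k := by
  induction k with
  | zero => simp [poch_succ, poch_zero]
  | succ k ih =>
    rw [poch_succ, ih, poch_succ]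
    push_cast
    ring

/-- The falling product in the binomial consists of the last `s` factors of `(ν+1)_(r+s)`. This
trades the Gamma quotients of the Bessel series for the binomials in `jacobi`. -/
theorem factorial_mul_choose_mul_poch (ν : ℝ) (r s : ℕ) :
    (s ! : ℝ) * Ring.choose ((r + s : ℕ) + ν : ℝ) s * poch (ν + 1) r = poch (ν + 1) (r + s) := by
  rw [factorial_mul_choose_eq_prod]
  induction s with
  | zero => simp
  | succ s ih =>
    rw [Finset.prod_range_succ', ← add_assoc, poch_succ, ← ih]
    have : ∀ i : ℕ, ((r + s + 1 : ℕ) : ℝ) + ν - ((i + 1 : ℕ) : ℝ) = ((r + s : ℕ) : ℝ) + ν - i := by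
      intro i
      push_cast
      ring
    simp only [this]
    push_cast
    ring

theorem Gamma_add_nat {a : ℝ} (ha : 0 < a) (r : ℕ) :
    Real.Gamma (r + a) = poch a r * Real.Gamma a := by
  induction r with
  | zero => simp [poch_zero]
  | succ r ih =>
    have h : ((r + 1 : ℕ) : ℝ) + a = (r + a) + 1 := by
      push_cast
      ring
    rw [h, Real.Gamma_add_one (by positivity), ih, poch_succ]
    ring

/-- The coefficient of `D ^ (2 * r)` on `x ^ (2 * b)` or `x ^ (2 * b + 1)`, up to the factor
`4 ^ r`. -/
noncomputable def dropCoeff (α : ℝ) (b r : ℕ) : ℝ :=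
  (b.descFactorial r : ℝ) * ((r ! : ℝ) * Ring.choose ((b : ℝ) + α - 1) r)

theorem dropCoeff_zero (α : ℝ) (b : ℕ) : dropCoeff α b 0 = 1 := by simp [dropCoeff]

theorem dropCoeff_succ (α : ℝ) (b r : ℕ) (h : r ≤ b) :
    dropCoeff α b (r + 1) = dropCoeff α b r * (((b - r : ℕ) : ℝ) * ((b - r : ℕ) + α - 1)) := by
  simp only [dropCoeff, factorial_mul_choose_eq_prod, Finset.prod_range_succ,
    Nat.descFactorial_succ]
  push_cast [h]
  ring

/-- The two halves are `-N/R` and `ξ²/R` with `R = N + ξ²`, and the total degree `b` clears the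
denominator. If `R = 0` then `N = ξ² = 0`, and both sides are `1` for `b = 0` and `0` otherwise;
this is why the final identity needs no exceptional points. -/
theorem pow_mul_half_pow (ξ N : ℝ) (hN : 0 ≤ N) (b s : ℕ) (hs : s ≤ b) :
    (N + ξ ^ 2) ^ b * ((((ξ ^ 2 - N) / (N + ξ ^ 2) - 1) / 2) ^ s *
      (((ξ ^ 2 - N) / (N + ξ ^ 2) + 1) / 2) ^ (b - s)) = (-N) ^ s * (ξ ^ 2) ^ (b - s) := by
  obtain ⟨k, rfl⟩ := Nat.exists_eq_add_of_le hs
  rw [Nat.add_sub_cancel_left]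
  by_cases hR : N + ξ ^ 2 = 0
  · have hξ : ξ ^ 2 = 0 := by nlinarith [sq_nonneg ξ]
    have hN0 : N = 0 := by nlinarith
    rw [hξ, hN0]
    rcases s with _ | s
    · rcases k with _ | k <;> simp
    · simp [pow_succ]
  · have h1 : ((ξ ^ 2 - N) / (N + ξ ^ 2) - 1) / 2 = -N / (N + ξ ^ 2) := by
      field_simp
      ring
    have h2 : ((ξ ^ 2 - N) / (N + ξ ^ 2) + 1) / 2 = ξ ^ 2 / (N + ξ ^ 2) := by
      field_simp
      ring
    rw [h1, h2, div_pow, div_pow, pow_add]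
    field_simp

theorem bessel_sum_eq_jacobi (ξ N α ν : ℝ) (hN : 0 ≤ N) (hν : 0 < ν + 1) (b : ℕ) :
    Real.Gamma (ν + 1) * ∑ r ∈ Finset.range (b + 1),
        1 / ((r ! : ℝ) * Real.Gamma (r + ν + 1)) * dropCoeff α b r * ξ ^ (2 * r) * (-N) ^ (b - r) =
      (b ! : ℝ) * (N + ξ ^ 2) ^ b / poch (ν + 1) b *
        jacobi (b : ℤ) (α - 1) ν ((ξ ^ 2 - N) / (N + ξ ^ 2)) := by
  have hG : 0 < Real.Gamma (ν + 1) := Real.Gamma_pos_of_pos hν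
  change _ = _ * ∑ s ∈ Finset.range (b + 1), _
  -- The Bessel index `r` corresponds to the Jacobi index `s = b - r`; after this reversal the sums
  -- agree term by term.
  rw [← Finset.sum_range_reflect, Finset.mul_sum, Finset.mul_sum]
  refine Finset.sum_congr rfl fun s hs => ?_
  have hsb : s ≤ b := Nat.lt_succ_iff.mp (Finset.mem_range.mp hs)
  have hp := pow_mul_half_pow ξ N hN b s hsb
  obtain ⟨r, rfl⟩ := Nat.exists_eq_add_of_le' hsb
  have e1 : r + s + 1 - 1 - s = r := by omega
  have e2 : r + s - r = s := by omega
  have e3 : r + s - s = r := by omega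
  rw [e3] at hp
  simp only [e1, e2, e3]
  have hpoch := factorial_mul_choose_mul_poch ν r s
  have hdf : (s ! : ℝ) * ((r + s).descFactorial r : ℝ) = ((r + s)! : ℝ) := by
    have := Nat.factorial_mul_descFactorial (Nat.le_add_right r s)
    rw [e2] at this
    exact_mod_cast this
  have h1 := (poch_pos hν r).ne'
  have h2 := (poch_pos hν (r + s)).ne'
  have h3 : (r ! : ℝ) ≠ 0 := by positivity
  have h4 : (s ! : ℝ) ≠ 0 := by positivity
  have hα : ((r + s : ℕ) : ℝ) + (α - 1) = ((r + s : ℕ) : ℝ) + α - 1 := by ring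
  rw [add_assoc (r : ℝ) ν 1, Gamma_add_nat hν, dropCoeff, pow_mul, hα]
  have hC : Ring.choose (((r + s : ℕ) : ℝ) + ν) s = poch (ν + 1) (r + s) / (s ! * poch (ν + 1) r) := by
    rw [eq_div_iff (by positivity), ← hpoch]
    ring
  rw [hC, ← hdf]
  generalize Ring.choose (((r + s : ℕ) : ℝ) + α - 1) r = c
  generalize ((r + s).descFactorial r : ℝ) = d
  generalize ((ξ ^ 2 - N) / (N + ξ ^ 2) - 1) / 2 = p at *
  generalize ((ξ ^ 2 - N) / (N + ξ ^ 2) + 1) / 2 = q at *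
  calc _ = d * c / poch (ν + 1) r * ((-N) ^ s * (ξ ^ 2) ^ r) := by
        field_simp
    _ = _ := by
        rw [← hp]
        field_simp

/-! ### Commutation relations -/

theorem refl_X_self {n : ℕ} (i : Fin n) :
    refl i (MvPolynomial.X i) = -MvPolynomial.X i := by simp [refl]

theorem refl_X_of_ne {n : ℕ} {i k : Fin n} (h : k ≠ i) :
    refl i (MvPolynomial.X k) = MvPolynomial.X k := by simp [refl, h]

theorem divX_X_mul {n : ℕ} (i : Fin n) (p : MvPolynomial (Fin n) ℝ) :
    divX i (MvPolynomial.X i * p) = p := by simp [divX]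

theorem dunkl_apply {n : ℕ} (μ : Fin n → ℝ) (i : Fin n) (p : MvPolynomial (Fin n) ℝ) :
    dunkl μ i p = MvPolynomial.pderiv i p + μ i • divX i (p - refl i p) := rfl

theorem dunkl_X_mul_self {n : ℕ} (μ : Fin n → ℝ) (i : Fin n) (p : MvPolynomial (Fin n) ℝ) :
    dunkl μ i (MvPolynomial.X i * p) =
      MvPolynomial.X i * dunkl μ i p + p + (2 * μ i) • refl i p := by
  have h : MvPolynomial.X i * p - refl i (MvPolynomial.X i * p) =
      MvPolynomial.X i * (p + refl i p) := by
    rw [map_mul, refl_X_self]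
    ring
  rw [dunkl_apply, dunkl_apply, h, divX_X_mul, mul_add, mul_smul_comm, X_mul_divX_sub_refl,
    Derivation.leibniz, MvPolynomial.pderiv_X_self, smul_eq_mul, smul_eq_mul, mul_one]
  module

theorem dunkl_X_mul_of_ne {n : ℕ} (μ : Fin n → ℝ) {i k : Fin n} (hk : k ≠ i)
    (p : MvPolynomial (Fin n) ℝ) :
    dunkl μ i (MvPolynomial.X k * p) = MvPolynomial.X k * dunkl μ i p := by
  have h : MvPolynomial.X k * p - refl i (MvPolynomial.X k * p) =
      MvPolynomial.X i * (MvPolynomial.X k * divX i (p - refl i p)) := by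
    rw [map_mul, refl_X_of_ne hk, mul_left_comm, X_mul_divX_sub_refl]
    ring
  rw [dunkl_apply, dunkl_apply, h, divX_X_mul, mul_add, mul_smul_comm,
    Derivation.leibniz, MvPolynomial.pderiv_X_of_ne hk, smul_eq_mul, smul_zero, add_zero]

theorem dunkl_one {n : ℕ} (μ : Fin n → ℝ) (i : Fin n) : dunkl μ i 1 = 0 := by
  simp [dunkl_apply]

section Operators

variable {n : ℕ} (V : Type*) [AddCommGroup V] [Module ℝ V]

/-- The reflection `r_i` on `V`-valued polynomials. -/
noncomputable def reflOp (i : Fin n) : Module.End ℝ (MvPolynomial (Fin n) ℝ ⊗[ℝ] V) :=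
  LinearMap.rTensor V (refl i).toLinearMap

theorem mulOp_comm (i k : Fin n) : mulOp V i * mulOp V k = mulOp V k * mulOp V i := by
  refine TensorProduct.ext' fun p v => ?_
  simp [mulOp, mul_left_comm]

theorem dunklOp_mul_mulOp_self (μ : Fin n → ℝ) (i : Fin n) :
    dunklOp V μ i * mulOp V i = mulOp V i * dunklOp V μ i + 1 + (2 * μ i) • reflOp V i := by
  refine TensorProduct.ext' fun p v => ?_
  simp [mulOp, dunklOp, reflOp, dunkl_X_mul_self, TensorProduct.add_tmul, TensorProduct.smul_tmul']

theorem dunklOp_mul_mulOp_of_ne (μ : Fin n → ℝ) {i k : Fin n} (h : k ≠ i) :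
    dunklOp V μ i * mulOp V k = mulOp V k * dunklOp V μ i := by
  refine TensorProduct.ext' fun p v => ?_
  simp [mulOp, dunklOp, dunkl_X_mul_of_ne μ h]

theorem reflOp_mul_mulOp_self (i : Fin n) :
    reflOp V i * mulOp V i = -(mulOp V i * reflOp V i) := by
  refine TensorProduct.ext' fun p v => ?_
  simp [mulOp, reflOp, refl_X_self, TensorProduct.neg_tmul]

theorem reflOp_mul_mulOp_of_ne {i k : Fin n} (h : k ≠ i) :
    reflOp V i * mulOp V k = mulOp V k * reflOp V i := by
  refine TensorProduct.ext' fun p v => ?_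
  simp [mulOp, reflOp, refl_X_of_ne h]

variable [Module (Cl n) V] [IsScalarTower ℝ (Cl n) V]

theorem genOp_mul_mulOp (i k : Fin n) : genOp V i * mulOp V k = mulOp V k * genOp V i := by
  refine TensorProduct.ext' fun p v => ?_
  simp [mulOp, genOp]

theorem genOp_mul_dunklOp (μ : Fin n → ℝ) (i k : Fin n) :
    genOp V i * dunklOp V μ k = dunklOp V μ k * genOp V i := by
  refine TensorProduct.ext' fun p v => ?_
  simp [dunklOp, genOp]

theorem genOp_mul_reflOp (i k : Fin n) : genOp V i * reflOp V k = reflOp V k * genOp V i := by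
  refine TensorProduct.ext' fun p v => ?_
  simp [reflOp, genOp]

theorem genOp_mul_self (i : Fin n) : genOp V i * genOp V i = -1 := by
  refine TensorProduct.ext' fun p v => ?_
  simp [genOp, ← mul_smul, e_mul_self, TensorProduct.tmul_neg]

theorem genOp_anticomm {i k : Fin n} (h : i ≠ k) :
    genOp V i * genOp V k = -(genOp V k * genOp V i) := by
  refine TensorProduct.ext' fun p v => ?_
  have h' := e_anticomm h
  rw [add_eq_zero_iff_eq_neg] at h'
  simp [genOp, ← mul_smul, h', TensorProduct.tmul_neg]

end Operators

/-! ### The `osp(1|2)` relations between position, Dirac-Dunkl and Euler operators -/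

section Ring

variable {A : Type*} [Ring A]

theorem mul_add_mul_of_mul_self_eq_neg_one [Algebra ℝ A] {a x t : A} (ha : a * a = -1)
    (hx : a * x = x * a) (ht : a * t = t * a) :
    a * x * (a * t) + a * t * (a * x) = (-2 : ℝ) • ((1 / 2 : ℝ) • (x * t + t * x)) := by
  have h1 : a * x * (a * t) = -(x * t) := by
    rw [hx, mul_assoc, ← mul_assoc a, ha, neg_one_mul, mul_neg]
  have h2 : a * t * (a * x) = -(t * x) := by
    rw [ht, mul_assoc, ← mul_assoc a, ha, neg_one_mul, mul_neg]
  rw [h1, h2]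
  module

theorem mul_add_mul_eq_zero_of_anticomm {a b x t : A} (hab : a * b = -(b * a))
    (hx : b * x = x * b) (ht : a * t = t * a) (hxt : t * x = x * t) :
    a * x * (b * t) + b * t * (a * x) = 0 := by
  have h1 : a * x * (b * t) = a * b * (x * t) := by
    rw [mul_assoc, ← mul_assoc x, ← hx, mul_assoc, mul_assoc]
  have h2 : b * t * (a * x) = b * a * (x * t) := by
    rw [mul_assoc, ← mul_assoc t, ← ht, mul_assoc, hxt, mul_assoc]
  rw [h1, h2, hab, neg_mul, neg_add_cancel]

theorem sum_mul_eq_neg_mul_sum {ι : Type*} {s : Finset ι} {f : ι → A} {a : A}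
    (h : ∀ k ∈ s, f k * a = -(a * f k)) : (∑ k ∈ s, f k) * a = -(a * ∑ k ∈ s, f k) := by
  rw [Finset.sum_mul, Finset.mul_sum, ← Finset.sum_neg_distrib]
  exact Finset.sum_congr rfl h

end Ring

section Euler

variable {n : ℕ} (V : Type*) [AddCommGroup V] [Module ℝ V]

/-- The operator `x_i ∂_i + μ_i + 1/2`, as half the anticommutator of `x_i` and `T_i`. -/
noncomputable def eulerOp (μ : Fin n → ℝ) (i : Fin n) :
    Module.End ℝ (MvPolynomial (Fin n) ℝ ⊗[ℝ] V) :=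
  (1 / 2 : ℝ) • (mulOp V i * dunklOp V μ i + dunklOp V μ i * mulOp V i)

/-- The operator `E_[ℓ] + γ_[ℓ]`, with `E_[ℓ]` the Euler operator in the first `ℓ` variables. -/
noncomputable def eulerSum (μ : Fin n → ℝ) (l : ℕ) :
    Module.End ℝ (MvPolynomial (Fin n) ℝ ⊗[ℝ] V) :=
  ∑ i ∈ seg n l, eulerOp V μ i

theorem mem_seg {l : ℕ} {i : Fin n} : i ∈ seg n l ↔ (i : ℕ) < l := by simp [seg]

theorem seg_succ (i : Fin n) : seg n (i + 1) = insert i (seg n i) := by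
  ext k
  simp only [Finset.mem_insert, mem_seg, Fin.ext_iff]
  omega

theorem self_notMem_seg (i : Fin n) : i ∉ seg n i := by simp [mem_seg]

theorem seg_zero : seg n 0 = ∅ := by
  ext k
  simp [mem_seg]

/-- The two reflection terms cancel because `r_i` anticommutes with `x_i`. So `μ_i` drops out, and
`eulerOp` counts degree in `x_i` up to a constant. -/
theorem dunklOp_mul_mulOp_sq (μ : Fin n → ℝ) (i : Fin n) :
    dunklOp V μ i * mulOp V i * mulOp V i =
      mulOp V i * mulOp V i * dunklOp V μ i + (2 : ℝ) • mulOp V i := by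
  rw [dunklOp_mul_mulOp_self, add_mul, add_mul, mul_assoc, dunklOp_mul_mulOp_self, smul_mul_assoc,
    reflOp_mul_mulOp_self, mul_add, mul_add, mul_smul_comm, mul_one, one_mul, mul_assoc]
  module

theorem eulerOp_mul_mulOp_self (μ : Fin n → ℝ) (i : Fin n) :
    eulerOp V μ i * mulOp V i = mulOp V i * eulerOp V μ i + mulOp V i := by
  have h := dunklOp_mul_mulOp_sq V μ i
  rw [eulerOp, smul_mul_assoc, add_mul, h, mul_smul_comm, mul_add]
  simp only [mul_assoc]
  module

theorem eulerOp_mul_mulOp_of_ne (μ : Fin n → ℝ) {i k : Fin n} (h : k ≠ i) :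
    eulerOp V μ i * mulOp V k = mulOp V k * eulerOp V μ i := by
  have h1 : Commute (dunklOp V μ i) (mulOp V k) := dunklOp_mul_mulOp_of_ne V μ h
  have h2 : Commute (mulOp V i) (mulOp V k) := mulOp_comm V i k
  exact (((h2.mul_left h1).add_left (h1.mul_left h2)).smul_left (1 / 2 : ℝ)).eq

theorem eulerSum_mul_mulOp_of_lt (μ : Fin n → ℝ) {l : ℕ} {k : Fin n} (h : (k : ℕ) < l) :
    eulerSum V μ l * mulOp V k = mulOp V k * eulerSum V μ l + mulOp V k := by
  have hk : k ∈ seg n l := mem_seg.mpr h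
  rw [eulerSum, ← Finset.add_sum_erase _ _ hk, add_mul, mul_add, eulerOp_mul_mulOp_self,
    Finset.sum_mul, Finset.mul_sum, Finset.sum_congr rfl fun i hi =>
      eulerOp_mul_mulOp_of_ne V μ (Finset.ne_of_mem_erase hi).symm]
  abel

theorem eulerSum_mul_mulOp_of_le (μ : Fin n → ℝ) {l : ℕ} {k : Fin n} (h : l ≤ k) :
    eulerSum V μ l * mulOp V k = mulOp V k * eulerSum V μ l := by
  rw [eulerSum, Finset.sum_mul, Finset.mul_sum]
  refine Finset.sum_congr rfl fun i hi => eulerOp_mul_mulOp_of_ne V μ ?_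
  rintro rfl
  exact absurd (mem_seg.mp hi) (not_lt.mpr h)

variable [Module (Cl n) V] [IsScalarTower ℝ (Cl n) V]

theorem eulerOp_mul_genOp (μ : Fin n → ℝ) (i k : Fin n) :
    eulerOp V μ i * genOp V k = genOp V k * eulerOp V μ i := by
  have h1 : Commute (dunklOp V μ i) (genOp V k) := (genOp_mul_dunklOp V μ k i).symm
  have h2 : Commute (mulOp V i) (genOp V k) := (genOp_mul_mulOp V k i).symm
  exact (((h2.mul_left h1).add_left (h1.mul_left h2)).smul_left (1 / 2 : ℝ)).eq

theorem eulerSum_mul_genOp (μ : Fin n → ℝ) (l : ℕ) (k : Fin n) :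
    eulerSum V μ l * genOp V k = genOp V k * eulerSum V μ l := by
  rw [eulerSum, Finset.sum_mul, Finset.mul_sum]
  exact Finset.sum_congr rfl fun i _ => eulerOp_mul_genOp V μ i k

theorem eulerSum_mul_posOp (μ : Fin n → ℝ) (l : ℕ) :
    eulerSum V μ l * posOp V l = posOp V l * eulerSum V μ l + posOp V l := by
  simp only [posOp]
  rw [Finset.mul_sum, Finset.sum_mul, ← Finset.sum_add_distrib]
  refine Finset.sum_congr rfl fun i hi => ?_
  rw [← mul_assoc, eulerSum_mul_genOp, mul_assoc, eulerSum_mul_mulOp_of_lt V μ (mem_seg.mp hi),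
    mul_add, mul_assoc]

/-- Off-diagonal terms cancel: `e_i` and `e_k` anticommute while `x_i` and `T_k` commute. A diagonal
term is `-(x_i T_i + T_i x_i)` because `e_i² = -1`. -/
theorem posOp_mul_diracOp_add (μ : Fin n → ℝ) (l : ℕ) :
    posOp V l * diracOp V μ l + diracOp V μ l * posOp V l = (-2 : ℝ) • eulerSum V μ l := by
  simp only [posOp, diracOp, eulerSum]
  rw [Finset.sum_mul_sum, Finset.sum_comm, Finset.sum_mul_sum, ← Finset.sum_add_distrib,
    Finset.smul_sum]
  refine Finset.sum_congr rfl fun i hi => ?_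
  rw [← Finset.sum_add_distrib, Finset.sum_eq_single_of_mem i hi]
  · exact mul_add_mul_of_mul_self_eq_neg_one
      (A := Module.End ℝ (MvPolynomial (Fin n) ℝ ⊗[ℝ] V)) (genOp_mul_self V i) (genOp_mul_mulOp V i i)
      (genOp_mul_dunklOp V μ i i)
  · intro k _ hk
    exact mul_add_mul_eq_zero_of_anticomm
      (A := Module.End ℝ (MvPolynomial (Fin n) ℝ ⊗[ℝ] V)) (genOp_anticomm V hk) (genOp_mul_mulOp V i k)
      (genOp_mul_dunklOp V μ k i) (dunklOp_mul_mulOp_of_ne V μ hk)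

theorem commute_posOp {A : Module.End ℝ (MvPolynomial (Fin n) ℝ ⊗[ℝ] V)} (l : ℕ)
    (hg : ∀ k, Commute A (genOp V k)) (hm : ∀ k : Fin n, (k : ℕ) < l → Commute A (mulOp V k)) :
    Commute A (posOp V l) :=
  Commute.sum_right _ _ _ fun k hk => (hg k).mul_right (hm k (mem_seg.mp hk))

theorem commute_dunklOp_posOp (μ : Fin n → ℝ) {i : Fin n} {l : ℕ} (h : l ≤ i) :
    Commute (dunklOp V μ i) (posOp V l) :=
  commute_posOp V l (fun k => (genOp_mul_dunklOp V μ k i).symm) fun k hk =>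
    dunklOp_mul_mulOp_of_ne V μ (by
      rintro rfl
      omega)

theorem commute_reflOp_posOp {i : Fin n} {l : ℕ} (h : l ≤ i) :
    Commute (reflOp V i) (posOp V l) :=
  commute_posOp V l (fun k => (genOp_mul_reflOp V k i).symm) fun k hk =>
    reflOp_mul_mulOp_of_ne V (by
      rintro rfl
      omega)

theorem commute_mulOp_diracOp (μ : Fin n → ℝ) {i : Fin n} {l : ℕ} (h : l ≤ i) :
    Commute (mulOp V i) (diracOp V μ l) :=
  Commute.sum_right _ _ _ fun k hk =>
    Commute.mul_right (genOp_mul_mulOp V k i).symm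
      (dunklOp_mul_mulOp_of_ne V μ (by
        rintro rfl
        exact absurd (mem_seg.mp hk) (not_lt.mpr h))).symm

theorem diracOp_mul_genOp (μ : Fin n → ℝ) {i : Fin n} {l : ℕ} (h : l ≤ i) :
    diracOp V μ l * genOp V i = -(genOp V i * diracOp V μ l) := by
  refine sum_mul_eq_neg_mul_sum (A := Module.End ℝ (MvPolynomial (Fin n) ℝ ⊗[ℝ] V)) fun k hk => ?_
  have hk' : k ≠ i := by
    rintro rfl
    exact absurd (mem_seg.mp hk) (not_lt.mpr h)
  rw [mul_assoc, ← genOp_mul_dunklOp, ← mul_assoc, genOp_anticomm V hk', ← mul_assoc]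
  rfl

end Euler

/-! ### Action of the Dirac-Dunkl operator on `x^p F` for monogenic `F` -/

section Monogenic

variable {n : ℕ} {V : Type*} [AddCommGroup V] [Module ℝ V] [Module (Cl n) V]
  [IsScalarTower ℝ (Cl n) V]

/-- `F` is a `V`-valued polynomial in the first `l` variables, annihilated by `D_[l]` and
homogeneous of degree `c - γ_[l]`. -/
structure IsMonogenic (μ : Fin n → ℝ) (l : ℕ) (c : ℝ) (F : MvPolynomial (Fin n) ℝ ⊗[ℝ] V) :
    Prop where
  dirac : diracOp V μ l F = 0
  euler : eulerSum V μ l F = c • F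
  dunkl : ∀ i : Fin n, l ≤ i → dunklOp V μ i F = 0
  refl : ∀ i : Fin n, l ≤ i → reflOp V i F = F

namespace IsMonogenic

variable {μ : Fin n → ℝ} {l : ℕ} {c : ℝ} {F : MvPolynomial (Fin n) ℝ ⊗[ℝ] V}

theorem eulerSum_posOp_pow (hF : IsMonogenic μ l c F) (p : ℕ) :
    eulerSum V μ l ((posOp V l ^ p) F) = (c + p) • (posOp V l ^ p) F := by
  induction p with
  | zero => simp [hF.euler]
  | succ p ih =>
    have h := LinearMap.congr_fun (eulerSum_mul_posOp V μ l) ((posOp V l ^ p) F)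
    simp only [Module.End.mul_apply, LinearMap.add_apply, ih, map_smul] at h
    rw [pow_succ', Module.End.mul_apply, h]
    push_cast
    module

theorem dunklOp_posOp_pow (hF : IsMonogenic μ l c F) (p : ℕ) {i : Fin n} (h : l ≤ i) :
    dunklOp V μ i ((posOp V l ^ p) F) = 0 := by
  have h := LinearMap.congr_fun ((commute_dunklOp_posOp V μ h).pow_right p).eq F
  simpa [hF.dunkl i ‹_›] using h

theorem reflOp_posOp_pow (hF : IsMonogenic μ l c F) (p : ℕ) {i : Fin n} (h : l ≤ i) :
    reflOp V i ((posOp V l ^ p) F) = (posOp V l ^ p) F := by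
  have h := LinearMap.congr_fun ((commute_reflOp_posOp V h).pow_right p).eq F
  simpa [hF.refl i ‹_›] using h

theorem diracOp_posOp_pow_succ (hF : IsMonogenic μ l c F) (p : ℕ) :
    diracOp V μ l ((posOp V l ^ (p + 1)) F) =
      (-2 * (c + p)) • (posOp V l ^ p) F - posOp V l (diracOp V μ l ((posOp V l ^ p) F)) := by
  have h := LinearMap.congr_fun (posOp_mul_diracOp_add V μ l) ((posOp V l ^ p) F)
  simp only [Module.End.mul_apply, LinearMap.add_apply,
    LinearMap.smul_apply, hF.eulerSum_posOp_pow, smul_smul] at h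
  rw [pow_succ', Module.End.mul_apply, ← h]
  abel

/-- The recursion of `diracOp_posOp_pow_succ` passes from each power to the next, so the odd and
even formulas are proved in one induction. -/
theorem diracOp_posOp_pow_odd_even (hF : IsMonogenic μ l c F) (b : ℕ) :
    diracOp V μ l ((posOp V l ^ (2 * b + 1)) F) = -((2 * (b + c)) • (posOp V l ^ (2 * b)) F) ∧
    diracOp V μ l ((posOp V l ^ (2 * b + 2)) F) =
      -((2 * (b + 1 : ℝ)) • (posOp V l ^ (2 * b + 1)) F) := by
  have key : ∀ b : ℕ,
      diracOp V μ l ((posOp V l ^ (2 * b + 1)) F) = -((2 * (b + c)) • (posOp V l ^ (2 * b)) F) →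
      diracOp V μ l ((posOp V l ^ (2 * b + 2)) F) =
        -((2 * (b + 1 : ℝ)) • (posOp V l ^ (2 * b + 1)) F) := by
    intro b h
    rw [hF.diracOp_posOp_pow_succ (2 * b + 1), h, map_neg, map_smul, ← Module.End.mul_apply,
      ← pow_succ']
    push_cast
    module
  induction b with
  | zero =>
    have h0 : diracOp V μ l ((posOp V l ^ (2 * 0 + 1)) F) =
        -((2 * ((0 : ℕ) + c)) • (posOp V l ^ (2 * 0)) F) := by
      rw [hF.diracOp_posOp_pow_succ]
      simp only [hF.dirac, pow_zero, mul_zero, Module.End.one_apply, map_zero, Nat.cast_zero]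
      module
    exact ⟨h0, key 0 h0⟩
  | succ b ih =>
    have h1 : diracOp V μ l ((posOp V l ^ (2 * (b + 1) + 1)) F) =
        -((2 * ((b + 1 : ℕ) + c)) • (posOp V l ^ (2 * (b + 1))) F) := by
      rw [hF.diracOp_posOp_pow_succ, show 2 * (b + 1) = 2 * b + 2 by ring, ih.2, map_neg, map_smul,
        ← Module.End.mul_apply, ← pow_succ']
      push_cast
      module
    exact ⟨h1, key _ h1⟩

theorem diracOp_posOp_pow_odd (hF : IsMonogenic μ l c F) (b : ℕ) :
    diracOp V μ l ((posOp V l ^ (2 * b + 1)) F) = -((2 * (b + c)) • (posOp V l ^ (2 * b)) F) :=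
  (hF.diracOp_posOp_pow_odd_even b).1

theorem diracOp_posOp_pow_even (hF : IsMonogenic μ l c F) (b : ℕ) :
    diracOp V μ l ((posOp V l ^ (2 * b)) F) =
      -((2 * b : ℝ) • (posOp V l ^ (2 * b - 1)) F) := by
  rcases b with _ | b
  · simp [hF.dirac]
  · have h := (hF.diracOp_posOp_pow_odd_even b).2
    rw [show 2 * (b + 1) - 1 = 2 * b + 1 by omega, Nat.cast_succ]
    exact h

theorem exists_diracOp_posOp_pow (hF : IsMonogenic μ l c F) (p : ℕ) :
    ∃ κ : ℝ, diracOp V μ l ((posOp V l ^ p) F) = κ • (posOp V l ^ (p - 1)) F ∧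
      (p = 0 → κ = 0) := by
  rcases Nat.even_or_odd' p with ⟨b, rfl | rfl⟩
  · exact ⟨-(2 * b), (hF.diracOp_posOp_pow_even b).trans (neg_smul _ _).symm, fun h => by
      have : b = 0 := by omega
      simp [this]⟩
  · exact ⟨-(2 * (b + c)), (hF.diracOp_posOp_pow_odd b).trans (neg_smul _ _).symm, by omega⟩

/-- Lets `D^a x^p F` inherit homogeneity, reflection invariance and `T_i`-annihilation from `x^(p-a)
F`. The second clause covers truncated subtraction: for `p < a` the result is zero. -/
theorem exists_diracOp_pow_posOp_pow (hF : IsMonogenic μ l c F) (p a : ℕ) :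
    ∃ κ : ℝ, (diracOp V μ l ^ a) ((posOp V l ^ p) F) = κ • (posOp V l ^ (p - a)) F ∧
      (p < a → κ = 0) := by
  induction a with
  | zero => exact ⟨1, by simp, by omega⟩
  | succ a ih =>
    obtain ⟨κ, h, hκ⟩ := ih
    obtain ⟨κ', h', hκ'⟩ := hF.exists_diracOp_posOp_pow (p - a)
    refine ⟨κ * κ', ?_, fun hpa => ?_⟩
    · rw [pow_succ', Module.End.mul_apply, h, map_smul, h', smul_smul, Nat.sub_sub]
    · rw [hκ' (by omega), mul_zero]

theorem diracOp_pow_posOp_pow_of_lt (hF : IsMonogenic μ l c F) {p a : ℕ} (h : p < a) :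
    (diracOp V μ l ^ a) ((posOp V l ^ p) F) = 0 := by
  obtain ⟨κ, h1, h2⟩ := hF.exists_diracOp_pow_posOp_pow p a
  rw [h1, h2 h, zero_smul]

theorem dunklOp_diracOp_pow (hF : IsMonogenic μ l c F) (p a : ℕ) {i : Fin n} (h : l ≤ i) :
    dunklOp V μ i ((diracOp V μ l ^ a) ((posOp V l ^ p) F)) = 0 := by
  obtain ⟨κ, h1, -⟩ := hF.exists_diracOp_pow_posOp_pow p a
  rw [h1, map_smul, hF.dunklOp_posOp_pow _ h, smul_zero]

theorem reflOp_diracOp_pow (hF : IsMonogenic μ l c F) (p a : ℕ) {i : Fin n} (h : l ≤ i) :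
    reflOp V i ((diracOp V μ l ^ a) ((posOp V l ^ p) F)) =
      (diracOp V μ l ^ a) ((posOp V l ^ p) F) := by
  obtain ⟨κ, h1, -⟩ := hF.exists_diracOp_pow_posOp_pow p a
  rw [h1, map_smul, hF.reflOp_posOp_pow _ h]

theorem eulerSum_diracOp_pow (hF : IsMonogenic μ l c F) (p a : ℕ) :
    eulerSum V μ l ((diracOp V μ l ^ a) ((posOp V l ^ p) F)) =
      (c + p - a) • (diracOp V μ l ^ a) ((posOp V l ^ p) F) := by
  obtain ⟨κ, h1, h2⟩ := hF.exists_diracOp_pow_posOp_pow p a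
  rcases lt_or_ge p a with h | h
  · simp [hF.diracOp_pow_posOp_pow_of_lt h]
  · rw [h1, map_smul, hF.eulerSum_posOp_pow, smul_comm, Nat.cast_sub h, add_sub_assoc]

end IsMonogenic

end Monogenic

/-! ### Bessel series of operators that become scalars on evaluation -/

section Bessel

variable {W : Type*} [AddCommGroup W] [Module ℝ W]

theorem besselOp_eq_sum (α : ℝ) {X D : Module.End ℝ W} (hXD : Commute X D) {f : W} {N : ℕ}
    (h : ∀ r, N ≤ r → (D ^ (2 * r)) f = 0) :
    besselOp α (X * D) f = ∑ r ∈ Finset.range N,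
      (1 / (2 ^ (2 * r) * (r ! : ℝ) * Real.Gamma (r + α + 1))) •
        (X ^ (2 * r)) ((D ^ (2 * r)) f) := by
  simp only [besselOp, hXD.mul_pow, Module.End.mul_apply]
  refine finsum_eq_sum_of_support_subset _ fun r hr => ?_
  by_contra hN
  simp only [Finset.coe_range, Set.mem_Iio, not_lt] at hN
  exact hr (by simp [h r hN])

theorem map_besselOp_of_map_eq_smul (α : ℝ) {X D : Module.End ℝ W} (hXD : Commute X D)
    {f g : W} {κ : ℝ} (hfg : D f = κ • g) {N : ℕ} (hf : ∀ r, N ≤ r → (D ^ (2 * r)) f = 0)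
    (hg : ∀ r, N ≤ r → (D ^ (2 * r)) g = 0) :
    D (besselOp α (X * D) f) = κ • besselOp α (X * D) g := by
  rw [besselOp_eq_sum α hXD hf, besselOp_eq_sum α hXD hg, map_sum, Finset.smul_sum]
  refine Finset.sum_congr rfl fun r _ => ?_
  have h1 : D ((X ^ (2 * r)) ((D ^ (2 * r)) f)) = (X ^ (2 * r)) ((D ^ (2 * r)) (D f)) := by
    have h2 := (((Commute.refl D).pow_right (2 * r)).eq)
    have h3 := ((hXD.symm.pow_right (2 * r)).eq)
    rw [← Module.End.mul_apply D, h3, Module.End.mul_apply, ← Module.End.mul_apply D, h2,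
      Module.End.mul_apply]
  rw [map_smul, h1, hfg, map_smul, map_smul, smul_comm]

/-- Stated for an abstract sequence to serve both parities: `f b = x^(2b) F` with `α = c`, and `f b
= x^(2b+1) F` with `α = c + 1`. -/
theorem pow_apply_of_sq_apply_succ {D : Module.End ℝ W} {f : ℕ → W} {α : ℝ}
    (hs : ∀ b : ℕ, D (D (f (b + 1))) = (4 * (b + 1) * (b + α)) • f b) (b r : ℕ) (h : r ≤ b) :
    (D ^ (2 * r)) (f b) = (4 ^ r * dropCoeff α b r) • f (b - r) := by
  induction r with
  | zero => simp [dropCoeff_zero]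
  | succ r ih =>
    obtain ⟨k, rfl⟩ := Nat.exists_eq_add_of_le' h
    rw [show 2 * (r + 1) = 2 + 2 * r by ring, pow_add, Module.End.mul_apply, ih (by omega), pow_two,
      Module.End.mul_apply, map_smul, map_smul, dropCoeff_succ _ _ _ (by omega),
      show k + (r + 1) - r = k + 1 by omega, hs, smul_smul, Nat.add_sub_cancel]
    push_cast
    congr 1
    ring

theorem pow_apply_eq_zero_of_sq_apply_succ {D : Module.End ℝ W} {f : ℕ → W} {α : ℝ}
    (h0 : D (D (f 0)) = 0)
    (hs : ∀ b : ℕ, D (D (f (b + 1))) = (4 * (b + 1) * (b + α)) • f b) {b r : ℕ} (h : b + 1 ≤ r) :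
    (D ^ (2 * r)) (f b) = 0 := by
  obtain ⟨k, rfl⟩ := Nat.exists_eq_add_of_le' h
  rw [show 2 * (k + (b + 1)) = 2 * k + 2 + 2 * b by ring, pow_add, pow_add, Module.End.mul_apply,
    Module.End.mul_apply, pow_apply_of_sq_apply_succ hs b b le_rfl, map_smul, pow_two,
    Module.End.mul_apply, Nat.sub_self, h0, smul_zero, map_zero]

/-- Here `L` stands for evaluation at a point: `X` becomes the scalar `ξ`, and each step of `f` the
scalar `-N`. What remains is the sum in `bessel_sum_eq_jacobi`. -/
theorem Gamma_smul_map_besselOp {U : Type*} [AddCommGroup U] [Module ℝ U] (L : W →ₗ[ℝ] U)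
    {X D : Module.End ℝ W} (hXD : Commute X D) {f : ℕ → W} {α ν ξ N : ℝ}
    (hN : 0 ≤ N) (hν : 0 < ν + 1) (h0 : D (D (f 0)) = 0)
    (hs : ∀ b : ℕ, D (D (f (b + 1))) = (4 * (b + 1) * (b + α)) • f b)
    (hX : ∀ g, L (X g) = ξ • L g) (hf : ∀ b, L (f (b + 1)) = (-N) • L (f b)) (b : ℕ) :
    Real.Gamma (ν + 1) • L (besselOp ν (X * D) (f b)) =
      ((b ! : ℝ) * (N + ξ ^ 2) ^ b / poch (ν + 1) b *
        jacobi (b : ℤ) (α - 1) ν ((ξ ^ 2 - N) / (N + ξ ^ 2))) • L (f 0) := by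
  have hXp : ∀ (a : ℕ) (g : W), L ((X ^ a) g) = ξ ^ a • L g := by
    intro a g
    induction a with
    | zero => simp
    | succ a ih => rw [pow_succ', Module.End.mul_apply, hX, ih, smul_smul, pow_succ']
  have hfp : ∀ b : ℕ, L (f b) = (-N) ^ b • L (f 0) := by
    intro b
    induction b with
    | zero => simp
    | succ b ih => rw [hf, ih, smul_smul, pow_succ']
  rw [besselOp_eq_sum ν hXD fun r hr => pow_apply_eq_zero_of_sq_apply_succ h0 hs hr,
    ← bessel_sum_eq_jacobi ξ N α ν hN hν b, map_sum, mul_smul, Finset.sum_smul]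
  refine congrArg _ (Finset.sum_congr rfl fun r hr => ?_)
  rw [pow_apply_of_sq_apply_succ hs b r (Nat.lt_succ_iff.mp (Finset.mem_range.mp hr)), map_smul,
    map_smul, map_smul, hXp, hfp, smul_smul, smul_smul, smul_smul, pow_mul (2 : ℝ)]
  congr 1
  rw [show (2 : ℝ) ^ 2 = 4 by norm_num]
  field_simp

end Bessel

/-! ### The Cauchy-Kovalevskaia extension preserves monogenicity -/

section Extension

variable {n : ℕ} {V : Type*} [AddCommGroup V] [Module ℝ V]

section Powers

variable {μ : Fin n → ℝ} {i : Fin n} {g : MvPolynomial (Fin n) ℝ ⊗[ℝ] V}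

theorem eulerOp_mulOp_pow (hT : dunklOp V μ i g = 0) (hR : reflOp V i g = g) (a : ℕ) :
    eulerOp V μ i ((mulOp V i ^ a) g) = (a + 1 / 2 + μ i) • (mulOp V i ^ a) g := by
  induction a with
  | zero =>
    have h := LinearMap.congr_fun (dunklOp_mul_mulOp_self V μ i) g
    simp only [Module.End.mul_apply, LinearMap.add_apply, LinearMap.smul_apply, hT, hR, map_zero,
      Module.End.one_apply] at h
    simp only [pow_zero, Module.End.one_apply, eulerOp, LinearMap.smul_apply, LinearMap.add_apply,
      Module.End.mul_apply, hT, map_zero, h]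
    push_cast
    module
  | succ a ih =>
    have h := LinearMap.congr_fun (eulerOp_mul_mulOp_self V μ i) ((mulOp V i ^ a) g)
    simp only [Module.End.mul_apply, LinearMap.add_apply, ih, map_smul] at h
    rw [pow_succ', Module.End.mul_apply, h]
    push_cast
    module

theorem dunklOp_mulOp_pow_succ (hT : dunklOp V μ i g = 0) (hR : reflOp V i g = g) (a : ℕ) :
    dunklOp V μ i ((mulOp V i ^ (a + 1)) g) =
      (2 * (a + 1 / 2 + μ i)) • (mulOp V i ^ a) g -
        mulOp V i (dunklOp V μ i ((mulOp V i ^ a) g)) := by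
  have h := eulerOp_mulOp_pow hT hR a
  simp only [eulerOp, LinearMap.smul_apply, LinearMap.add_apply, Module.End.mul_apply] at h
  rw [pow_succ', Module.End.mul_apply, mul_smul, ← h]
  module

theorem dunklOp_mulOp_pow_even (hT : dunklOp V μ i g = 0) (hR : reflOp V i g = g) (r : ℕ) :
    dunklOp V μ i ((mulOp V i ^ (2 * r)) g) = (2 * r : ℝ) • (mulOp V i ^ (2 * r - 1)) g := by
  induction r with
  | zero => simp [hT]
  | succ r ih =>
    rw [show 2 * (r + 1) = 2 * r + 1 + 1 by ring, dunklOp_mulOp_pow_succ hT hR,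
      dunklOp_mulOp_pow_succ hT hR, ih, Nat.add_sub_cancel, map_sub, map_smul, map_smul, map_smul,
      ← Module.End.mul_apply, ← pow_succ']
    have h : (2 * r : ℝ) • mulOp V i (mulOp V i ((mulOp V i ^ (2 * r - 1)) g)) =
        (2 * r : ℝ) • (mulOp V i ^ (2 * r + 1)) g := by
      rcases r with _ | r
      · simp
      · rw [← Module.End.mul_apply, ← Module.End.mul_apply, mul_assoc, ← pow_succ', ← pow_succ']
        rfl
    rw [h]
    push_cast
    module

theorem dunklOp_mulOp_pow_odd (hT : dunklOp V μ i g = 0) (hR : reflOp V i g = g) (r : ℕ) :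
    dunklOp V μ i ((mulOp V i ^ (2 * r + 1)) g) =
      (2 * r + 1 + 2 * μ i) • (mulOp V i ^ (2 * r)) g := by
  rw [dunklOp_mulOp_pow_succ hT hR, dunklOp_mulOp_pow_even hT hR]
  have h : mulOp V i ((2 * r : ℝ) • (mulOp V i ^ (2 * r - 1)) g) =
      (2 * r : ℝ) • (mulOp V i ^ (2 * r)) g := by
    rcases r with _ | r
    · simp
    · rw [map_smul, ← Module.End.mul_apply, ← pow_succ']
      rfl
  rw [h]
  push_cast
  module

end Powers

variable [Module (Cl n) V] [IsScalarTower ℝ (Cl n) V]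

/-- The `r`-th summand of `CK μ i f`. -/
noncomputable def extTerm (μ : Fin n → ℝ) (i : Fin n) (f : MvPolynomial (Fin n) ℝ ⊗[ℝ] V) (r : ℕ) :
    MvPolynomial (Fin n) ℝ ⊗[ℝ] V :=
  (1 / (2 ^ (2 * r) * (r ! : ℝ) * Real.Gamma (r + μ i + 1 / 2))) •
      (mulOp V i ^ (2 * r)) ((diracOp V μ i ^ (2 * r)) f) +
    (1 / 2 * (1 / (2 ^ (2 * r) * (r ! : ℝ) * Real.Gamma (r + μ i + 1 / 2 + 1)))) •
      genOp V i ((mulOp V i ^ (2 * r + 1)) ((diracOp V μ i ^ (2 * r + 1)) f))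

theorem CK_eq_sum (μ : Fin n → ℝ) (i : Fin n) {f : MvPolynomial (Fin n) ℝ ⊗[ℝ] V} {N : ℕ}
    (h : ∀ r, N ≤ r → (diracOp V μ i ^ (2 * r)) f = 0) :
    CK μ i f = Real.Gamma (μ i + 1 / 2) • ∑ r ∈ Finset.range N, extTerm μ i f r := by
  have hc := commute_mulOp_diracOp V μ (le_refl (i : ℕ))
  simp only [CK, extTerm]
  rw [besselOp_eq_sum _ hc h, besselOp_eq_sum _ hc h, Finset.sum_add_distrib, map_sum,
    Finset.smul_sum]
  refine congrArg _ (congrArg₂ _ (Finset.sum_congr rfl fun r _ => ?_)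
    (Finset.sum_congr rfl fun r _ => ?_))
  · rw [show (r : ℝ) + (μ i - 1 / 2) + 1 = r + μ i + 1 / 2 by ring]
  · have h3 := (hc.symm.pow_right (2 * r)).eq
    rw [map_smul, smul_smul, Module.End.mul_apply, Module.End.mul_apply,
      ← Module.End.mul_apply (diracOp V μ i), h3, Module.End.mul_apply,
      ← Module.End.mul_apply (diracOp V μ i), ← pow_succ', ← Module.End.mul_apply (mulOp V i),
      ← pow_succ', show (r : ℝ) + (μ i + 1 / 2) + 1 = r + μ i + 1 / 2 + 1 by ring]

namespace IsMonogenic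

variable {μ : Fin n → ℝ} {i : Fin n} {c : ℝ} {F : MvPolynomial (Fin n) ℝ ⊗[ℝ] V}

theorem CK_posOp_pow_eq_sum (hF : IsMonogenic μ i c F) (p : ℕ) :
    CK μ i ((posOp V i ^ p) F) = Real.Gamma (μ i + 1 / 2) •
      ∑ r ∈ Finset.range (p + 1), extTerm μ i ((posOp V i ^ p) F) r :=
  CK_eq_sum μ i fun _ hr => hF.diracOp_pow_posOp_pow_of_lt (by omega)

/-- Split `D_[i+1] = e_i T_i + D_[i]`. On the even part `e_i T_i` gives `u r`; on the odd part
`D_[i]` gives `-u (r + 1)`. The two remaining terms, multiples of `x_i^(2r) D^(2r+1) f`, cancel by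
the choice of Gamma factors. -/
theorem diracOp_succ_extTerm (hF : IsMonogenic μ i c F) (hμ : 0 < μ i) (p r : ℕ) :
    let u : ℕ → MvPolynomial (Fin n) ℝ ⊗[ℝ] V := fun r =>
      (2 * r * (1 / (2 ^ (2 * r) * (r ! : ℝ) * Real.Gamma (r + μ i + 1 / 2)))) •
        genOp V i ((mulOp V i ^ (2 * r - 1)) ((diracOp V μ i ^ (2 * r)) ((posOp V i ^ p) F)))
    diracOp V μ (i + 1) (extTerm μ i ((posOp V i ^ p) F) r) = u r - u (r + 1) := by
  intro u
  have hD : diracOp V μ (i + 1) = genOp V i * dunklOp V μ i + diracOp V μ i := by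
    rw [diracOp, seg_succ, Finset.sum_insert (self_notMem_seg i)]
    rfl
  have hT := fun a => hF.dunklOp_diracOp_pow p a (le_refl (i : ℕ))
  have hR := fun a => hF.reflOp_diracOp_pow p a (le_refl (i : ℕ))
  set f := (posOp V i ^ p) F with hf
  have hDX : ∀ a g, diracOp V μ i ((mulOp V i ^ a) g) = (mulOp V i ^ a) (diracOp V μ i g) :=
    fun a g => LinearMap.congr_fun
      ((commute_mulOp_diracOp V μ (le_refl (i : ℕ))).symm.pow_right a).eq g
  have hDE : ∀ g, diracOp V μ i (genOp V i g) = -genOp V i (diracOp V μ i g) :=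
    fun g => LinearMap.congr_fun (diracOp_mul_genOp V μ (le_refl (i : ℕ))) g
  have hTE : ∀ g, dunklOp V μ i (genOp V i g) = genOp V i (dunklOp V μ i g) :=
    fun g => (LinearMap.congr_fun (genOp_mul_dunklOp V μ i i) g).symm
  have hEE : ∀ g, genOp V i (genOp V i g) = -g :=
    fun g => LinearMap.congr_fun (genOp_mul_self V i) g
  have hDD : ∀ a, diracOp V μ i ((diracOp V μ i ^ a) f) = (diracOp V μ i ^ (a + 1)) f := by
    intro a
    rw [pow_succ', Module.End.mul_apply]
  simp only [extTerm, hD, map_add, map_smul, LinearMap.add_apply, Module.End.mul_apply, hDX, hDE,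
    hTE, hEE, hDD, dunklOp_mulOp_pow_even (hT _) (hR _), dunklOp_mulOp_pow_odd (hT _) (hR _), u]
  rw [show 2 * (r + 1) - 1 = 2 * r + 1 by omega, show 2 * (r + 1) = 2 * r + 1 + 1 by ring]
  have hpos : (0 : ℝ) < r + μ i + 1 / 2 := by positivity
  have hG : Real.Gamma (r + μ i + 1 / 2 + 1) = (r + μ i + 1 / 2) * Real.Gamma (r + μ i + 1 / 2) :=
    Real.Gamma_add_one hpos.ne'
  have hG0 := (Real.Gamma_pos_of_pos hpos).ne'
  have e1 : ((r + 1 : ℕ) : ℝ) + μ i + 1 / 2 = r + μ i + 1 / 2 + 1 := by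
    push_cast
    ring
  -- `e2` identifies the coefficient of `u (r + 1)`; `e3` gives the cancellation of the two middle
  -- terms.
  have e2 : (2 * ((r + 1 : ℕ) : ℝ)) * (1 / (2 ^ (2 * r + 1 + 1) * ((r + 1)! : ℝ) *
      Real.Gamma (r + μ i + 1 / 2 + 1))) =
      1 / 2 * (1 / (2 ^ (2 * r) * (r ! : ℝ) * Real.Gamma (r + μ i + 1 / 2 + 1))) := by
    rw [hG, Nat.factorial_succ, pow_succ, pow_succ]
    push_cast
    have : (r ! : ℝ) ≠ 0 := by positivity
    have : (r + 1 : ℝ) ≠ 0 := by positivity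
    field_simp
  have e3 : 1 / (2 ^ (2 * r) * (r ! : ℝ) * Real.Gamma (r + μ i + 1 / 2)) =
      1 / 2 * (1 / (2 ^ (2 * r) * (r ! : ℝ) * Real.Gamma (r + μ i + 1 / 2 + 1))) *
        (2 * r + 1 + 2 * μ i) := by
    rw [hG]
    have : (r ! : ℝ) ≠ 0 := by positivity
    field_simp
    ring
  rw [e1, e2, e3]
  module

theorem map_extTerm {A : Module.End ℝ (MvPolynomial (Fin n) ℝ ⊗[ℝ] V)} {κ : ℝ}
    (f : MvPolynomial (Fin n) ℝ ⊗[ℝ] V) (hE : Commute A (genOp V i))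
    (hA : ∀ a, A ((mulOp V i ^ a) ((diracOp V μ i ^ a) f)) =
      κ • (mulOp V i ^ a) ((diracOp V μ i ^ a) f)) (r : ℕ) :
    A (extTerm μ i f r) = κ • extTerm μ i f r := by
  have hE' : ∀ g, A (genOp V i g) = genOp V i (A g) := fun g => LinearMap.congr_fun hE.eq g
  rw [extTerm, map_add, map_smul, map_smul, hE', hA, hA, map_smul, smul_add, smul_comm κ,
    smul_comm κ]

/-- Used with the Euler operator, with later Dunkl operators (`κ = 0`) and with later reflections
(`κ = 1`). -/
theorem map_CK_posOp_pow (hF : IsMonogenic μ i c F) (p : ℕ)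
    {A : Module.End ℝ (MvPolynomial (Fin n) ℝ ⊗[ℝ] V)} {κ : ℝ} (hE : Commute A (genOp V i))
    (hA : ∀ a, A ((mulOp V i ^ a) ((diracOp V μ i ^ a) ((posOp V i ^ p) F))) =
      κ • (mulOp V i ^ a) ((diracOp V μ i ^ a) ((posOp V i ^ p) F))) :
    A (CK μ i ((posOp V i ^ p) F)) = κ • CK μ i ((posOp V i ^ p) F) := by
  rw [hF.CK_posOp_pow_eq_sum, map_smul, map_sum, smul_comm κ, Finset.smul_sum (r := κ)]
  exact congrArg _ (Finset.sum_congr rfl fun r _ => map_extTerm _ hE hA r)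

/-- The Cauchy-Kovalevskaia extension of `x_[l] ^ p F` is monogenic if `F` is. -/
theorem CK_posOp_pow (hF : IsMonogenic μ i c F) (hμ : 0 < μ i) (p : ℕ) :
    IsMonogenic μ (i + 1) (c + p + 1 / 2 + μ i) (CK μ i ((posOp V i ^ p) F)) where
  dirac := by
    -- The telescoped sum is `u 0 - u (p + 1)`: the first vanishes by its factor `2r`, the second
    -- because `D^(2p+2)` kills `x^p F`.
    rw [hF.CK_posOp_pow_eq_sum, map_smul, map_sum,
      Finset.sum_congr rfl fun r _ => hF.diracOp_succ_extTerm hμ p r, Finset.sum_range_sub',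
      hF.diracOp_pow_posOp_pow_of_lt (by omega : p < 2 * (p + 1))]
    simp
  euler := by
    refine hF.map_CK_posOp_pow p (eulerSum_mul_genOp V μ _ _) fun a => ?_
    have hs : eulerSum V μ (i + 1) = eulerOp V μ i + eulerSum V μ i := by
      rw [eulerSum, seg_succ, Finset.sum_insert (self_notMem_seg i)]
      rfl
    have hc := LinearMap.congr_fun ((show Commute _ _ from
      eulerSum_mul_mulOp_of_le V μ (le_refl (i : ℕ))).pow_right a).eq
      ((diracOp V μ i ^ a) ((posOp V i ^ p) F))
    rw [Module.End.mul_apply, Module.End.mul_apply, hF.eulerSum_diracOp_pow, map_smul] at hc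
    rw [hs, LinearMap.add_apply, hc, eulerOp_mulOp_pow (hF.dunklOp_diracOp_pow p a le_rfl)
      (hF.reflOp_diracOp_pow p a le_rfl)]
    module
  dunkl k hk := by
    rw [← zero_smul ℝ (CK μ i ((posOp V i ^ p) F))]
    refine hF.map_CK_posOp_pow p (genOp_mul_dunklOp V μ i k).symm fun a => ?_
    have hki : i ≠ k := by
      rintro rfl
      omega
    have hc := LinearMap.congr_fun ((show Commute _ _ from
      dunklOp_mul_mulOp_of_ne V μ hki).pow_right a).eq ((diracOp V μ i ^ a) ((posOp V i ^ p) F))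
    rw [Module.End.mul_apply, Module.End.mul_apply, hF.dunklOp_diracOp_pow p a (by omega)] at hc
    rw [hc, map_zero, zero_smul]
  refl k hk := by
    refine (?_ : _ = (1 : ℝ) • _).trans (one_smul ℝ _)
    refine hF.map_CK_posOp_pow p (genOp_mul_reflOp V i k).symm fun a => ?_
    have hki : i ≠ k := by
      rintro rfl
      omega
    have hc := LinearMap.congr_fun ((show Commute _ _ from
      reflOp_mul_mulOp_of_ne V hki).pow_right a).eq ((diracOp V μ i ^ a) ((posOp V i ^ p) F))
    rw [Module.End.mul_apply, Module.End.mul_apply, hF.reflOp_diracOp_pow p a (by omega)] at hc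
    rw [hc, one_smul]

end IsMonogenic

end Extension

/-! ### Pointwise values of the extension: the factors `Q` -/

section Evaluation

variable {n : ℕ} {V : Type*} [AddCommGroup V] [Module ℝ V]

/-- The value at the point `x` of a `V`-valued polynomial, as a linear map. -/
noncomputable def evalHom (V : Type*) [AddCommGroup V] [Module ℝ V] (x : Fin n → ℝ) :
    MvPolynomial (Fin n) ℝ ⊗[ℝ] V →ₗ[ℝ] V :=
  (TensorProduct.lid ℝ V).toLinearMap ∘ₗ LinearMap.rTensor V (MvPolynomial.aeval x).toLinearMap

theorem evalHom_tmul (x : Fin n → ℝ) (p : MvPolynomial (Fin n) ℝ) (v : V) :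
    evalHom V x (p ⊗ₜ[ℝ] v) = MvPolynomial.aeval x p • v := by simp [evalHom]

theorem evalHom_mulOp (x : Fin n → ℝ) (i : Fin n) (g : MvPolynomial (Fin n) ℝ ⊗[ℝ] V) :
    evalHom V x (mulOp V i g) = x i • evalHom V x g := by
  induction g using TensorProduct.induction_on with
  | zero => simp
  | tmul p v => simp [mulOp, evalHom_tmul, mul_smul]
  | add a b ha hb => rw [map_add, map_add, ha, hb, map_add, smul_add]

variable [Module (Cl n) V] [IsScalarTower ℝ (Cl n) V]

theorem evalHom_genOp (x : Fin n → ℝ) (i : Fin n) (g : MvPolynomial (Fin n) ℝ ⊗[ℝ] V) :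
    evalHom V x (genOp V i g) = (e i : Cl n) • evalHom V x g := by
  induction g using TensorProduct.induction_on with
  | zero => simp
  | tmul p v =>
    rw [evalHom_tmul, smul_comm]
    exact evalHom_tmul x p _
  | add a b ha hb => rw [map_add, map_add, ha, hb, map_add, smul_add]

theorem evalHom_posOp (x : Fin n → ℝ) (l : ℕ) (g : MvPolynomial (Fin n) ℝ ⊗[ℝ] V) :
    evalHom V x (posOp V l g) = vec x l • evalHom V x g := by
  simp only [posOp, vec, LinearMap.sum_apply, map_sum, Finset.sum_smul]
  refine Finset.sum_congr rfl fun i _ => ?_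
  rw [Module.End.mul_apply, evalHom_genOp, evalHom_mulOp, smul_assoc, smul_comm]

theorem vec_mul_self (x : Fin n → ℝ) (l : ℕ) :
    vec x l * vec x l = algebraMap ℝ (Cl n) (-normSq x l) := by
  have h : vec x l =
      CliffordAlgebra.ι (negForm n) (∑ i ∈ seg n l, x i • Pi.single i 1) := by
    simp [vec, e, map_sum]
  have h2 : (∑ i ∈ seg n l, x i • Pi.single i 1 : Fin n → ℝ) =
      fun k => if k ∈ seg n l then x k else 0 := by
    ext k
    simp [Finset.sum_apply, Pi.single_apply]
  have h3 : negForm n (fun k => if k ∈ seg n l then x k else 0) = -normSq x l := by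
    simp [negForm, QuadraticMap.weightedSumSquares_apply, normSq, ← pow_two]
  rw [h, CliffordAlgebra.ι_sq_scalar, h2, h3]

theorem evalHom_posOp_posOp (x : Fin n → ℝ) (l : ℕ) (g : MvPolynomial (Fin n) ℝ ⊗[ℝ] V) :
    evalHom V x (posOp V l (posOp V l g)) = (-normSq x l) • evalHom V x g := by
  rw [evalHom_posOp, evalHom_posOp, smul_smul, vec_mul_self, algebraMap_smul]

theorem smul_algebraMap_sub_smul (K a s : ℝ) (y w : Cl n) (u : V) :
    (K • (algebraMap ℝ (Cl n) a - s • (y * w))) • u = (K * a) • u + (-(K * s)) • y • w • u := by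
  rw [smul_assoc, sub_smul, algebraMap_smul, smul_assoc, mul_smul, smul_sub, smul_smul, smul_smul,
    neg_smul, sub_eq_add_neg]

theorem smul_smul_sub_smul (K a s : ℝ) (y w : Cl n) (u : V) :
    (K • (a • w - s • y)) • u = (K * a) • w • u + (-(K * s)) • y • u := by
  rw [smul_assoc, sub_smul, smul_assoc, smul_assoc, smul_sub, smul_smul, smul_smul, neg_smul,
    sub_eq_add_neg]

theorem normSq_succ (x : Fin n → ℝ) (i : Fin n) :
    normSq x (i + 1) = normSq x i + x i ^ 2 := by
  rw [normSq, seg_succ, Finset.sum_insert (self_notMem_seg i), add_comm]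
  rfl

theorem normSq_nonneg (x : Fin n → ℝ) (l : ℕ) : 0 ≤ normSq x l :=
  Finset.sum_nonneg fun _ _ => sq_nonneg _

namespace IsMonogenic

variable {μ : Fin n → ℝ} {i : Fin n} {c : ℝ} {F : MvPolynomial (Fin n) ℝ ⊗[ℝ] V}

theorem Gamma_smul_evalHom_besselOp_even (hF : IsMonogenic μ i c F) (x : Fin n → ℝ) {ν : ℝ}
    (hν : 0 < ν + 1) (b : ℕ) :
    Real.Gamma (ν + 1) • evalHom V x
        (besselOp ν (mulOp V i * diracOp V μ i) ((posOp V i ^ (2 * b)) F)) =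
      ((b ! : ℝ) * normSq x (i + 1) ^ b / poch (ν + 1) b *
        jacobi (b : ℤ) (c - 1) ν (jacobiArg x i)) • evalHom V x F := by
  rw [jacobiArg, normSq_succ]
  refine Gamma_smul_map_besselOp (evalHom V x) (f := fun b => (posOp V i ^ (2 * b)) F)
    (commute_mulOp_diracOp V μ le_rfl) (normSq_nonneg x i) hν ?_ (fun b => ?_)
    (evalHom_mulOp x i) (fun b => ?_) b
  · simp [hF.dirac]
  · rw [hF.diracOp_posOp_pow_even, show 2 * (b + 1) - 1 = 2 * b + 1 by omega, map_neg, map_smul,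
      hF.diracOp_posOp_pow_odd]
    push_cast
    module
  · rw [mul_add, mul_one, pow_succ', pow_succ', Module.End.mul_apply, Module.End.mul_apply,
      evalHom_posOp_posOp]

theorem Gamma_smul_evalHom_besselOp_odd (hF : IsMonogenic μ i c F) (x : Fin n → ℝ) {ν : ℝ}
    (hν : 0 < ν + 1) (b : ℕ) :
    Real.Gamma (ν + 1) • evalHom V x
        (besselOp ν (mulOp V i * diracOp V μ i) ((posOp V i ^ (2 * b + 1)) F)) =
      ((b ! : ℝ) * normSq x (i + 1) ^ b / poch (ν + 1) b *
        jacobi (b : ℤ) c ν (jacobiArg x i)) • vec x i • evalHom V x F := by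
  have h := Gamma_smul_map_besselOp (evalHom V x) (f := fun b => (posOp V i ^ (2 * b + 1)) F)
    (α := c + 1) (commute_mulOp_diracOp V μ le_rfl) (normSq_nonneg x i) hν ?_ (fun b => ?_)
    (evalHom_mulOp x i) (fun b => ?_) b
  · rw [jacobiArg, normSq_succ, h, add_sub_cancel_right, mul_zero, zero_add, pow_one, evalHom_posOp]
  · rw [hF.diracOp_posOp_pow_odd, map_neg, map_smul]
    simp [hF.dirac]
  · rw [hF.diracOp_posOp_pow_odd, map_neg, map_smul, hF.diracOp_posOp_pow_even,
      show 2 * (b + 1) - 1 = 2 * b + 1 by omega]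
    push_cast
    module
  · rw [show 2 * (b + 1) + 1 = 2 * b + 1 + 1 + 1 by ring, pow_succ', pow_succ' _ (2 * b + 1),
      Module.End.mul_apply, Module.End.mul_apply, evalHom_posOp_posOp]

theorem diracOp_besselOp (hF : IsMonogenic μ i c F) (ν : ℝ) {p q : ℕ} {κ : ℝ}
    (h : diracOp V μ i ((posOp V i ^ p) F) = κ • (posOp V i ^ q) F) :
    diracOp V μ i (besselOp ν (mulOp V i * diracOp V μ i) ((posOp V i ^ p) F)) =
      κ • besselOp ν (mulOp V i * diracOp V μ i) ((posOp V i ^ q) F) :=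
  map_besselOp_of_map_eq_smul ν (commute_mulOp_diracOp V μ le_rfl) h (N := p + q + 1)
    (fun _ hr => hF.diracOp_pow_posOp_pow_of_lt (by omega))
    (fun _ hr => hF.diracOp_pow_posOp_pow_of_lt (by omega))

/-- `D` commutes with the Bessel series in `x_i D`, so in the second half of `CK` it can act first
on `x^p F`, which flips the parity of the power. -/
theorem evalHom_CK (hF : IsMonogenic μ i c F) (x : Fin n → ℝ) {p q : ℕ} {κ : ℝ}
    (h : diracOp V μ i ((posOp V i ^ p) F) = κ • (posOp V i ^ q) F) :
    evalHom V x (CK μ i ((posOp V i ^ p) F)) =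
      Real.Gamma (μ i + 1 / 2) • evalHom V x
        (besselOp (μ i - 1 / 2) (mulOp V i * diracOp V μ i) ((posOp V i ^ p) F)) +
      (1 / 2 * κ * x i) • (e i : Cl n) • Real.Gamma (μ i + 1 / 2) • evalHom V x
        (besselOp (μ i + 1 / 2) (mulOp V i * diracOp V μ i) ((posOp V i ^ q) F)) := by
  rw [CK, map_smul, map_add, map_smul, Module.End.mul_apply, Module.End.mul_apply,
    hF.diracOp_besselOp _ h, evalHom_genOp, evalHom_mulOp, map_smul, smul_add]
  congr 1
  simp only [smul_comm (e i : Cl n) (_ : ℝ), smul_smul]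
  congr 1
  ring

theorem evalHom_CK_posOp_pow {d : ℕ} (hF : IsMonogenic μ i (d + gam μ i) F) (hμ : 0 < μ i)
    (x : Fin n → ℝ) (k : ℕ) :
    evalHom V x (CK μ i ((posOp V i ^ k) F)) = Q μ x d k i • evalHom V x F := by
  -- The second Bessel series has index `μ_i + 1/2`, so its normalising factor is `Γ(μ_i + 3/2)`.
  have hG : ∀ w : V, Real.Gamma (μ i + 1 / 2) • w =
      (μ i + 1 / 2)⁻¹ • Real.Gamma (μ i + 1 / 2 + 1) • w := by
    intro w
    rw [Real.Gamma_add_one (by positivity), mul_smul, inv_smul_smul₀ (by positivity)]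
  have hν1 : μ i - 1 / 2 + 1 = μ i + 1 / 2 := by ring
  have hν0 : 0 < μ i - 1 / 2 + 1 := by linarith
  have hν2 : 0 < μ i + 1 / 2 + 1 := by linarith
  rcases Nat.even_or_odd' k with ⟨b, rfl | rfl⟩
  · have he := hF.Gamma_smul_evalHom_besselOp_even x hν0 b
    rw [hν1] at he
    rw [Q, if_pos (even_two_mul b), Nat.mul_div_cancel_left b two_pos]
    rcases b with _ | b
    -- For `k = 0` the second half vanishes since `D F = 0`, matching `P_(-1) = 0`.
    · rw [hF.evalHom_CK x (κ := 0) (q := 0) (by simp [hF.dirac]), he]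
      have hj : ∀ a b t, jacobi (((0 : ℕ) : ℤ) - 1) a b t = 0 := fun _ _ _ => rfl
      rw [hj]
      simp [jacobi, poch_zero]
    · rw [hF.evalHom_CK x ((hF.diracOp_posOp_pow_even (b + 1)).trans (neg_smul _ _).symm), he,
        show 2 * (b + 1) - 1 = 2 * b + 1 by omega, hG,
        hF.Gamma_smul_evalHom_besselOp_odd x hν2 b]
      rw [show ((b + 1 : ℕ) : ℤ) - 1 = (b : ℤ) by push_cast; ring, poch_succ_left]
      rw [smul_algebraMap_sub_smul, smul_comm (e i : Cl n) (_ : ℝ), smul_comm (e i : Cl n) (_ : ℝ),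
        smul_smul, smul_smul]
      congr 2
      have hp := (poch_pos hν2 b).ne'
      have hm : μ i + 1 / 2 ≠ 0 := by positivity
      rw [Nat.factorial_succ]
      -- Where the norm vanishes so does `x i`, hence both coefficients are zero and the quotient in
      -- `Q` does no harm.
      by_cases hR : normSq x (i + 1) = 0
      · have hx : x i = 0 := by
          have h1 := normSq_succ x i
          have h2 := normSq_nonneg x i
          nlinarith [sq_nonneg (x i)]
        simp [hx]
      · push_cast
        field_simp
        ring
  · have ho := hF.Gamma_smul_evalHom_besselOp_odd x hν0 b
    rw [hν1] at ho
    rw [Q, if_neg (by simp), show (2 * b + 1) / 2 = b by omega,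
      hF.evalHom_CK x ((hF.diracOp_posOp_pow_odd b).trans (neg_smul _ _).symm), ho, hG,
      hF.Gamma_smul_evalHom_besselOp_even x hν2 b]
    have hp1 := (poch_pos (by positivity : 0 < μ i + 1 / 2) b).ne'
    have hp2 := (poch_pos hν2 b).ne'
    have hm : μ i + 1 / 2 ≠ 0 := by positivity
    have hb : (b : ℝ) + μ i + 1 / 2 ≠ 0 := by positivity
    have hpp : poch (μ i + 1 / 2 + 1) b =
        poch (μ i + 1 / 2) b * (b + μ i + 1 / 2) / (μ i + 1 / 2) := by
      rw [eq_div_iff hm, mul_comm, ← poch_succ_left, poch_succ]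
      ring
    rw [hpp]
    rw [smul_smul_sub_smul, smul_comm (e i : Cl n) (_ : ℝ), smul_comm (e i : Cl n) (_ : ℝ),
      smul_smul, smul_smul]
    congr 2
    field_simp
    ring

end IsMonogenic

end Evaluation

/-! ### The base factor and induction along the tower -/

section Tower

variable {m : ℕ} {V : Type*} [AddCommGroup V] [Module ℝ V] [Module (Cl (m + 2)) V]
  [IsScalarTower ℝ (Cl (m + 2)) V]

theorem seg_one : seg (m + 2) ((1 : Fin (m + 2)) : ℕ) = {0} := by
  ext k
  rw [mem_seg, Finset.mem_singleton, Fin.val_one, Fin.ext_iff, Fin.val_zero, Nat.lt_one_iff]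

theorem gam_succ {n : ℕ} (μ : Fin n → ℝ) (i : Fin n) :
    gam μ (i + 1) = gam μ i + 1 / 2 + μ i := by
  rw [gam, gam, seg_succ, Finset.sum_insert (self_notMem_seg i)]
  push_cast
  ring

theorem isMonogenic_one_tmul (μ : Fin (m + 2) → ℝ) (w : V) :
    IsMonogenic μ ((1 : Fin (m + 2)) : ℕ) (((0 : ℕ) : ℝ) + gam μ ((1 : Fin (m + 2)) : ℕ))
      ((1 : MvPolynomial (Fin (m + 2)) ℝ) ⊗ₜ[ℝ] w) := by
  have hT : ∀ i, dunklOp V μ i ((1 : MvPolynomial (Fin (m + 2)) ℝ) ⊗ₜ[ℝ] w) = 0 := fun i => by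
    simp [dunklOp, dunkl_one]
  have hR : ∀ i, reflOp V i ((1 : MvPolynomial (Fin (m + 2)) ℝ) ⊗ₜ[ℝ] w) = 1 ⊗ₜ[ℝ] w :=
    fun i => by simp [reflOp]
  refine ⟨?_, ?_, fun i _ => hT i, fun i _ => hR i⟩
  · simp [diracOp, hT]
  · have h := eulerOp_mulOp_pow (hT 0) (hR 0) 0
    rw [eulerSum, gam, seg_one]
    simpa using h

theorem posOp_one_pow_tmul (k : ℕ) (w : V) :
    (posOp V ((1 : Fin (m + 2)) : ℕ) ^ k) ((1 : MvPolynomial (Fin (m + 2)) ℝ) ⊗ₜ[ℝ] w) =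
      (MvPolynomial.X 0 ^ k) ⊗ₜ[ℝ] ((e 0 : Cl (m + 2)) ^ k • w) := by
  induction k with
  | zero => simp
  | succ k ih =>
    rw [pow_succ', Module.End.mul_apply, ih, posOp, seg_one]
    simp [genOp, mulOp, pow_succ', mul_smul]

theorem e_pow_mul_neg_e_pow {n : ℕ} (i : Fin n) (k : ℕ) : (e i : Cl n) ^ k * (-e i) ^ k = 1 := by
  rw [← ((Commute.refl (e i)).neg_right).mul_pow, mul_neg, e_mul_self, neg_neg, one_pow]

theorem neg_e_pow_two_mul {n : ℕ} (i : Fin n) (b : ℕ) :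
    (-e i : Cl n) ^ (2 * b) = algebraMap ℝ (Cl n) ((-1) ^ b) := by
  rw [pow_mul, neg_sq, pow_two, e_mul_self]
  simp

theorem X_pow_tmul_eq_posOp_pow (k : ℕ) (v : V) :
    (MvPolynomial.X 0 ^ k : MvPolynomial (Fin (m + 2)) ℝ) ⊗ₜ[ℝ] v =
      (posOp V ((1 : Fin (m + 2)) : ℕ) ^ k)
        ((1 : MvPolynomial (Fin (m + 2)) ℝ) ⊗ₜ[ℝ] ((-e 0 : Cl (m + 2)) ^ k • v)) := by
  rw [posOp_one_pow_tmul, smul_smul, e_pow_mul_neg_e_pow, one_smul]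

/-- The sign `(-1)^β` of `mFactor` is `(-e_1)^(2β)`. In the odd case one more `-e_1` turns `e_1`
into `1` and `-e_2` into `e_2 e_1`. -/
theorem Q_one_mul_neg_e_pow (μ x : Fin (m + 2) → ℝ) (k : ℕ) :
    Q μ x 0 k 1 * (-e 0) ^ k = mFactor μ x k := by
  have hg : gam μ ((1 : Fin (m + 2)) : ℕ) = μ 0 + 1 / 2 := by
    rw [gam, seg_one]
    simp [add_comm]
  have hn : normSq x ((1 : Fin (m + 2)) : ℕ) = x 0 ^ 2 := by
    rw [normSq, seg_one, Finset.sum_singleton]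
  have hv : vec x ((1 : Fin (m + 2)) : ℕ) = x 0 • e 0 := by
    rw [vec, seg_one, Finset.sum_singleton]
  have ha : μ 0 + 1 / 2 - 1 = μ 0 - 1 / 2 := by ring
  simp only [Q, mFactor, jacobiArg, normSq_succ, hg, hn, hv, Nat.cast_zero, zero_add, ha, add_zero]
  rcases Nat.even_or_odd' k with ⟨b, rfl | rfl⟩
  · rw [if_pos (even_two_mul b), if_pos (even_two_mul b), neg_e_pow_two_mul,
      Nat.mul_div_cancel_left b two_pos, ← Algebra.commutes, ← Algebra.smul_def, smul_smul,
      mul_smul_comm, smul_smul]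
    congr 1
    · ring
    · congr 2
      ring
  · rw [if_neg (by simp), if_neg (by simp), pow_succ (-e 0), neg_e_pow_two_mul,
      show (2 * b + 1) / 2 = b by omega, ← mul_assoc, ← Algebra.commutes, ← Algebra.smul_def,
      smul_smul, smul_mul_assoc, sub_mul, smul_smul, smul_mul_assoc, smul_mul_assoc, mul_neg,
      mul_neg, e_mul_self, neg_neg, ← Algebra.algebraMap_eq_smul_one, smul_neg, sub_neg_eq_add]
    congr 1
    · ring
    · congr 2
      · ring
      · ring

theorem evalHom_CK_X_pow (μ : Fin (m + 2) → ℝ) (hμ : 0 < μ 1) (x : Fin (m + 2) → ℝ) (k : ℕ)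
    (v : V) :
    evalHom V x (CK μ 1 ((MvPolynomial.X 0 ^ k) ⊗ₜ[ℝ] v)) = mFactor μ x k • v := by
  rw [X_pow_tmul_eq_posOp_pow, (isMonogenic_one_tmul μ _).evalHom_CK_posOp_pow hμ, evalHom_tmul,
    map_one, one_smul, smul_smul, Q_one_mul_neg_e_pow]

theorem isMonogenic_CK_X_pow (μ : Fin (m + 2) → ℝ) (hμ : 0 < μ 1) (k : ℕ) (v : V) :
    IsMonogenic μ (0 + 2) ((k : ℝ) + gam μ (0 + 2))
      (CK μ 1 ((MvPolynomial.X 0 ^ k) ⊗ₜ[ℝ] v)) := by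
  have h := (isMonogenic_one_tmul μ ((-e 0 : Cl (m + 2)) ^ k • v)).CK_posOp_pow hμ k
  have hg := gam_succ μ 1
  rw [← X_pow_tmul_eq_posOp_pow] at h
  rw [Fin.val_one] at h hg
  rw [show 0 + 2 = 1 + 1 by rfl, hg]
  convert h using 1
  push_cast
  ring

theorem partialSum_succ {k : ℕ} (j : Fin k → ℕ) (i : Fin k) :
    partialSum j (i + 1) = partialSum j i + j i := by
  rw [partialSum, seg_succ, Finset.sum_insert (self_notMem_seg i), add_comm]
  rfl

/-- Each stage adds `j` to the degree and `1/2 + μ` to `γ`; the degree reached is the `d` entering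
the next `Q`. -/
theorem isMonogenic_tower (μ : Fin (m + 2) → ℝ) (hμ : ∀ i, 0 < μ i) (j : Fin (m + 1) → ℕ) (v : V)
    (l : ℕ) (hl : l ≤ m) :
    IsMonogenic μ (l + 2) ((partialSum j (l + 1) : ℝ) + gam μ (l + 2)) (tower μ j v l hl) := by
  induction l with
  | zero =>
    have h : partialSum j (0 + 1) = j 0 := by
      have := partialSum_succ j 0
      simpa [partialSum, seg_zero] using this
    rw [h]
    exact isMonogenic_CK_X_pow μ (hμ 1) (j 0) v
  | succ l ih =>
    have h := IsMonogenic.CK_posOp_pow (i := (⟨l, hl⟩ : Fin m).succ.succ)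
      (ih (Nat.le_of_succ_le hl)) (hμ _) (j (⟨l, hl⟩ : Fin m).succ)
    have hp := partialSum_succ j (⟨l, hl⟩ : Fin m).succ
    have hg := gam_succ μ (⟨l, hl⟩ : Fin m).succ.succ
    simp only [Fin.val_succ] at h hp hg
    have hc : ((partialSum j (l + 1) + j (⟨l, hl⟩ : Fin m).succ : ℕ) : ℝ) +
        (gam μ (l + 1 + 1) + 1 / 2 + μ (⟨l, hl⟩ : Fin m).succ.succ) =
        (partialSum j (l + 1) : ℝ) + gam μ (l + 2) + (j (⟨l, hl⟩ : Fin m).succ : ℝ) + 1 / 2 +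
          μ (⟨l, hl⟩ : Fin m).succ.succ := by
      push_cast
      ring
    rw [hp, hg, hc]
    exact h

theorem evalHom_tower (μ : Fin (m + 2) → ℝ) (hμ : ∀ i, 0 < μ i) (j : Fin (m + 1) → ℕ) (v : V)
    (x : Fin (m + 2) → ℝ) (l : ℕ) (hl : l ≤ m) :
    evalHom V x (tower μ j v l hl) =
      ((List.ofFn fun i : Fin l => Q μ x (partialSum j (i + 1)) (j (i.castLE hl).succ)
        (i.castLE hl).succ.succ).reverse.prod * mFactor μ x (j 0)) • v := by
  induction l with
  | zero =>
    simp only [List.ofFn_zero, List.reverse_nil, List.prod_nil, one_mul]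
    exact evalHom_CK_X_pow μ (hμ 1) x (j 0) v
  | succ l ih =>
    have h := IsMonogenic.evalHom_CK_posOp_pow (i := (⟨l, hl⟩ : Fin m).succ.succ)
      (isMonogenic_tower μ hμ j v l (Nat.le_of_succ_le hl)) (hμ _) x (j (⟨l, hl⟩ : Fin m).succ)
    -- The newest factor is last in the list, hence leftmost after reversal.
    rw [List.ofFn_succ', List.concat_eq_append, List.reverse_append, List.reverse_singleton,
      List.singleton_append, List.prod_cons, mul_assoc, mul_smul]
    refine h.trans ?_
    rw [ih (Nat.le_of_succ_le hl)]
    rfl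

end Tower

end DiracDunkl

/-- With `n = m + 2` variables: `Ψ_j(x) = Q_{j_{n-1}}(x_n, x_[n-1]) ⋯ Q_{j_2}(x_3, x_[2]) m_{j_1}(x_2, x_1) v`
at every point `x` of `ℝⁿ`. -/
theorem proposition7 (m : ℕ) {V : Type*} [AddCommGroup V] [Module ℝ V]
    [Module (DiracDunkl.Cl (m + 2)) V] [IsScalarTower ℝ (DiracDunkl.Cl (m + 2)) V]
    (μ : Fin (m + 2) → ℝ) (hμ : ∀ i, 0 < μ i) (j : Fin (m + 1) → ℕ) (v : V)
    (x : Fin (m + 2) → ℝ) :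
    DiracDunkl.evalAt x (DiracDunkl.Psi μ j v) =
      (DiracDunkl.QProd μ x j * DiracDunkl.mFactor μ x (j 0)) • v :=
  -- At `l = m` the `castLE` is the identity and `evalAt` unfolds to `evalHom`, both definitionally.
  DiracDunkl.evalHom_tower μ hμ j v x m le_rfl
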